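/- Let $m\ge 1$ and let $a,b,c$ be real numbers, each greater than $(m-1)/2$. Write $|X|=\det X$, $\operatorname{etr}(X)=\exp(\operatorname{tr}X)$, and $X>Y$ if $X-Y$ is symmetric positive definite. For a symmetric $m\times m$ matrix $X$ let $(dX)$ be Lebesgue measure in the coordinates $x_{ij}$, $i\le j$, and set $$\Gamma_m[a]=\int_{X>0}\operatorname{etr}(-X)\,|X|^{a-(m+1)/2}\,(dX),\qquad \beta^*_m[a,b,c]=\frac{\Gamma_m[a]\,\Gamma_m[b]\,\Gamma_m[c]}{\Gamma_m[a+b+c]} .$$ Let $\mathcal G_m(a,I_m)$ be the distribution on the matrices $A>0$ with density $\Gamma_m[a]^{-1}|A|^{a-(m+1)/2}\operatorname{etr}(-A)$ with respect to $(dA)$. The bimatrix variate generalised beta type I distribution $\mathcal{BGBI}_{2m\times m}(a,b,c)$ is the joint distribution of $$U_1=(A+C)^{-1/2}A\,\bigl((A+C)^{-1/2}\bigr)',\qquad U_2=(B+C)^{-1/2}B\,\bigl((B+C)^{-1/2}\bigr)',$$ where $A\sim\mathcal G_m(a,I_m)$, $B\sim\mathcal G_m(b,I_m)$, $C\sim\mathcal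 G_m(c,I_m)$ are independent, $C^{1/2}$ is the symmetric positive definite square root of $C$, and $(A+C)^{1/2}$, $(B+C)^{1/2}$ are the nonsingular factors $$(A+C)^{1/2}=C^{1/2}\bigl(I_m+C^{-1/2}AC^{-1/2}\bigr)^{1/2},\qquad (B+C)^{1/2}=C^{1/2}\bigl(I_m+C^{-1/2}BC^{-1/2}\bigr)^{1/2}$$ (again with symmetric roots on the right), which satisfy $X^{1/2}(X^{1/2})'=X$ for $X=A+C$ and $X=B+C$. Equivalently, $(I_m-U_1)^{-1}-I_m=C^{-1/2}AC^{-1/2}$ and $(I_m-U_2)^{-1}-I_m=C^{-1/2}BC^{-1/2}$. **Theorem.** If $(U_1,U_2)\sim\mathcal{BGBI}_{2m\times m}(a,b,c)$, then the pair $(V_1,V_2)=(U_1^{-1},U_2^{-1})$ has, with respect to $(dV_1)(dV_2)$, the density $$\frac{|V_1|^{-a-(m+1)/2}\,|V_2|^{-b-(m+1)/2}\,|I_m-V_1^{-1}|^{b+c-(m+1)/2}\,|I_m-V_2^{-1}|^{a+c-(m+1)/2}}{\beta^*_m[a,b,c]\;|I_m-(V_1V_2)^{-1}|^{a+b+c}},\qquad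 V_1>I_m,\ V_2>I_m,$$ and $0$ elsewhere. -/

import Mathlib

noncomputable section

namespace BimatrixBeta

open MeasureTheory
open scoped Matrix

/-- Matrices carry the product (entrywise) σ-algebra. -/
instance instMeasurableSpaceMatrix (m : ℕ) : MeasurableSpace (Matrix (Fin m) (Fin m) ℝ) :=
  inferInstanceAs (MeasurableSpace (Fin m → Fin m → ℝ))

/-- The symmetric matrix whose entries on and above the diagonal are the `x (i, j)`, `i ≤ j`. -/
def symmOfUpper (m : ℕ) (x : {p : Fin m × Fin m // p.1 ≤ p.2} → ℝ) :
    Matrix (Fin m) (Fin m) ℝ :=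
  Matrix.of fun i j => x ⟨(min i j, max i j), min_le_max⟩

/-- The measure `(dA) = ⋀_{i ≤ j} da_{ij}` on symmetric `m × m` matrices: Lebesgue measure in the
`m (m + 1) / 2` coordinates `a_{ij}`, `i ≤ j`, as a measure on all matrices which is carried by
the symmetric ones. -/
def symmVolume (m : ℕ) : Measure (Matrix (Fin m) (Fin m) ℝ) :=
  Measure.map (symmOfUpper m) volume

/-- The multivariate gamma function
`Γ_m[a] = ∫_{V > 0} etr(-V) |V|^{a - (m + 1) / 2} (dV)`. -/
def multivariateGamma (m : ℕ) (a : ℝ) : ℝ :=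
  ∫ V in {V : Matrix (Fin m) (Fin m) ℝ | V.PosDef},
    Real.exp (-V).trace * V.det ^ (a - ((m : ℝ) + 1) / 2) ∂(symmVolume m)

/-- `β*_m[a, b, c] = Γ_m[a] Γ_m[b] Γ_m[c] / Γ_m[a + b + c]`. -/
def betaStar (m : ℕ) (a b c : ℝ) : ℝ :=
  multivariateGamma m a * multivariateGamma m b * multivariateGamma m c
    / multivariateGamma m (a + b + c)

/-- The density of the matrix variate gamma distribution with respect to `(dA)`,
`|A|^{a - (m + 1) / 2} etr(-Θ⁻¹ A) / (Γ_m[a] |Θ|^a)` for `A > 0`, and `0` elsewhere. -/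
def matrixGammaDensity (m : ℕ) (a : ℝ) (Θ : Matrix (Fin m) (Fin m) ℝ) :
    Matrix (Fin m) (Fin m) ℝ → ℝ :=
  Set.indicator {A | A.PosDef} fun A =>
    1 / (multivariateGamma m a * Θ.det ^ a) * A.det ^ (a - ((m : ℝ) + 1) / 2)
      * Real.exp (-(Θ⁻¹ * A)).trace

/-- The matrix variate gamma distribution `𝒢_m(a, Θ)`. -/
def matrixGamma (m : ℕ) (a : ℝ) (Θ : Matrix (Fin m) (Fin m) ℝ) :
    Measure (Matrix (Fin m) (Fin m) ℝ) :=
  (symmVolume m).withDensity fun A => ENNReal.ofReal (matrixGammaDensity m a Θ A)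

section Roots

open scoped MatrixOrder

/-- The symmetric positive semidefinite square root. -/
def symmRoot {m : ℕ} (C : Matrix (Fin m) (Fin m) ℝ) : Matrix (Fin m) (Fin m) ℝ :=
  CFC.sqrt C

lemma symmRoot_mul_self {m : ℕ} {C : Matrix (Fin m) (Fin m) ℝ} (hC : C.PosSemidef) :
    symmRoot C * symmRoot C = C :=
  CFC.sqrt_mul_sqrt_self C hC.nonneg

lemma symmRoot_transpose {m : ℕ} (C : Matrix (Fin m) (Fin m) ℝ) :
    (symmRoot C)ᵀ = symmRoot C := by
  have h : (CFC.sqrt C).PosSemidef := Matrix.nonneg_iff_posSemidef.1 (CFC.sqrt_nonneg C)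
  simpa [Matrix.IsHermitian, symmRoot] using h.isHermitian

end Roots

/-- The ratio `F = C^{-1/2} A C^{-1/2}`, with the symmetric root of `C`. -/
def ratioII {m : ℕ} (A C : Matrix (Fin m) (Fin m) ℝ) : Matrix (Fin m) (Fin m) ℝ :=
  (symmRoot C)⁻¹ * A * (symmRoot C)⁻¹

/-- The nonsingular factor `(A + C)^{1/2} = C^{1/2} (I + C^{-1/2} A C^{-1/2})^{1/2}` of `A + C`
(see `sumRoot_mul_transpose`). -/
def sumRoot {m : ℕ} (A C : Matrix (Fin m) (Fin m) ℝ) : Matrix (Fin m) (Fin m) ℝ :=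
  symmRoot C * symmRoot (1 + ratioII A C)

/-- The beta type I matrix `U = (A + C)^{-1/2} A ((A + C)^{-1/2})'`, where `(A + C)^{1/2}` is the
factor `sumRoot A C` of `A + C`. Equivalently `(I - U)⁻¹ - I = C^{-1/2} A C^{-1/2}`
(see `inv_one_sub_ratioI`). -/
def ratioI {m : ℕ} (A C : Matrix (Fin m) (Fin m) ℝ) : Matrix (Fin m) (Fin m) ℝ :=
  (sumRoot A C)⁻¹ * A * ((sumRoot A C)⁻¹)ᵀ

/-- The bimatrix variate generalised beta type I distribution with parameters `a`, `b`, `c`: the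
joint law of `U₁ = (A + C)^{-1/2} A ((A + C)^{-1/2})'` and
`U₂ = (B + C)^{-1/2} B ((B + C)^{-1/2})'` for independent `A ∼ 𝒢_m(a, I)`, `B ∼ 𝒢_m(b, I)`,
`C ∼ 𝒢_m(c, I)`. -/
def bgbI (m : ℕ) (a b c : ℝ) :
    Measure (Matrix (Fin m) (Fin m) ℝ × Matrix (Fin m) (Fin m) ℝ) :=
  Measure.map (fun T => (ratioI T.1 T.2.2, ratioI T.2.1 T.2.2))
    ((matrixGamma m a 1).prod ((matrixGamma m b 1).prod (matrixGamma m c 1)))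

/-- The function of `(V₁, V₂)` which is
`|V₁|^{-a-(m+1)/2} |V₂|^{-b-(m+1)/2} |I - V₁⁻¹|^{b+c-(m+1)/2} |I - V₂⁻¹|^{a+c-(m+1)/2}`
`/ (β*_m[a, b, c] |I - (V₁ V₂)⁻¹|^{a+b+c})` for `V₁ > I`, `V₂ > I`, and `0` elsewhere. -/
def bgbIInvDensity (m : ℕ) (a b c : ℝ) :
    Matrix (Fin m) (Fin m) ℝ × Matrix (Fin m) (Fin m) ℝ → ℝ :=
  Set.indicator {V | (V.1 - 1).PosDef ∧ (V.2 - 1).PosDef} fun V =>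
    V.1.det ^ (-a - ((m : ℝ) + 1) / 2) * V.2.det ^ (-b - ((m : ℝ) + 1) / 2)
        * (1 - V.1⁻¹).det ^ (b + c - ((m : ℝ) + 1) / 2)
        * (1 - V.2⁻¹).det ^ (a + c - ((m : ℝ) + 1) / 2)
      / (betaStar m a b c * (1 - (V.1 * V.2)⁻¹).det ^ (a + b + c))

section Checks

open scoped MatrixOrder

variable {m : ℕ} {A C : Matrix (Fin m) (Fin m) ℝ}

lemma isUnit_det_symmRoot (hC : C.PosDef) : IsUnit (symmRoot C).det := by
  have h := congrArg Matrix.det (symmRoot_mul_self hC.posSemidef)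
  rw [Matrix.det_mul] at h
  refine isUnit_iff_ne_zero.2 fun h0 => ?_
  rw [h0, zero_mul] at h
  exact hC.det_pos.ne h

lemma posDef_one_add_ratioII (hA : A.PosSemidef) : (1 + ratioII A C).PosDef := by
  refine Matrix.PosDef.add_posSemidef Matrix.PosDef.one ?_
  have h := hA.mul_mul_conjTranspose_same (symmRoot C)⁻¹
  rwa [Matrix.conjTranspose_eq_transpose_of_trivial, Matrix.transpose_nonsing_inv,
    symmRoot_transpose] at h

/-- `sumRoot A C` is a factor of `A + C`. -/
lemma sumRoot_mul_transpose (hA : A.PosSemidef) (hC : C.PosDef) :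
    sumRoot A C * (sumRoot A C)ᵀ = A + C := by
  have hu := isUnit_det_symmRoot hC
  have hF := symmRoot_mul_self (posDef_one_add_ratioII (C := C) hA).posSemidef
  calc sumRoot A C * (sumRoot A C)ᵀ
      = symmRoot C * (symmRoot (1 + ratioII A C) * symmRoot (1 + ratioII A C)) * symmRoot C := by
        simp only [sumRoot, Matrix.transpose_mul, symmRoot_transpose, Matrix.mul_assoc]
    _ = symmRoot C * symmRoot C
          + (symmRoot C * (symmRoot C)⁻¹) * A * ((symmRoot C)⁻¹ * symmRoot C) := by
        rw [hF, ratioII]; noncomm_ring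
    _ = A + C := by
        rw [Matrix.mul_nonsing_inv _ hu, Matrix.nonsing_inv_mul _ hu,
          symmRoot_mul_self hC.posSemidef, Matrix.one_mul, Matrix.mul_one, add_comm]

/-- `(I - U)⁻¹ - I = C^{-1/2} A C^{-1/2}`. -/
lemma inv_one_sub_ratioI (hA : A.PosSemidef) :
    (1 - ratioI A C)⁻¹ - 1 = ratioII A C := by
  have hG := posDef_one_add_ratioII (C := C) hA
  have hs := isUnit_det_symmRoot hG
  have hF := symmRoot_mul_self hG.posSemidef
  set S := symmRoot (1 + ratioII A C) with hS
  have h1 : ratioI A C = S⁻¹ * ratioII A C * S⁻¹ := by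
    have hR : sumRoot A C = symmRoot C * S := rfl
    have hT : Sᵀ = S := symmRoot_transpose _
    simp only [ratioI, hR, Matrix.mul_inv_rev, Matrix.transpose_mul,
      Matrix.transpose_nonsing_inv, symmRoot_transpose, hT]
    simp only [ratioII, Matrix.mul_assoc]
  have h2 : ratioII A C = S * S - 1 := by rw [hF]; abel
  have h3 : 1 - ratioI A C = S⁻¹ * S⁻¹ := by
    rw [h1, h2]
    have : S⁻¹ * (S * S - 1) * S⁻¹ = (S⁻¹ * S) * (S * S⁻¹) - S⁻¹ * S⁻¹ := by noncomm_ring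
    rw [this, Matrix.mul_nonsing_inv _ hs, Matrix.nonsing_inv_mul _ hs]
    noncomm_ring
  rw [h3, h2, Matrix.mul_inv_rev, Matrix.nonsing_inv_nonsing_inv _ hs]

end Checks

end BimatrixBeta

end

/-! The key identity is `U₁⁻¹ = I + C^{1/2} A⁻¹ C^{1/2}`, and likewise for `U₂` with `B`
(`inv_ratioI`). For fixed `C` the map `A ↦ V₁` is therefore inverted by `A = C^{1/2} (V₁ - I)⁻¹
C^{1/2}`: a congruence, an inversion and a translation, with total Jacobian `|C|^{(m+1)/2} |V₁ -
I|^{-(m+1)}` (`setLIntegral_posDef_symmRoot_inv`).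

With `W_i = V_i - I` and `M = I + W₁⁻¹ + W₂⁻¹`, the product of the three gamma densities and the two
Jacobians is a constant times `|W₁|^{-a-(m+1)/2} |W₂|^{-b-(m+1)/2} etr(-M C) |C|^{a+b+c-(m+1)/2}`
(`jointKernel_eq`). Integrating out `C` gives `Γ_m[a+b+c] |M|^{-(a+b+c)}`
(`setLIntegral_exp_trace_mul_det_rpow`). The factorisation `V₁ V₂ - I = W₁ M W₂` then turns the
result into the stated density (`bgbIInvDensity_eq`).

Two analytic facts support this. The Jacobian of `X ↦ Q X Q'` on symmetric matrices is `|Q|^{m+1}`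
(`det_conjUpper`), and it also governs inversion, whose derivative is `H ↦ -X⁻¹ H X⁻¹`. The gamma
integral is finite and nonzero for `a > (m-1)/2` (`gammaLIntegral_lt_top`,
`gammaLIntegral_ne_zero`), so that integrals in `[0, ∞]` agree with the real constants. -/

noncomputable section

namespace BimatrixBeta

open MeasureTheory
open scoped Matrix ENNReal

variable {m : ℕ}

/-! ### Symmetric matrices in coordinates and the determinant of a congruence. -/

/-- Coordinates `x_{ij}`, `i ≤ j`, of a symmetric `m × m` matrix. -/
abbrev UpperCoord (m : ℕ) : Type := {p : Fin m × Fin m // p.1 ≤ p.2} → ℝ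

/-- `symmOfUpper` as a linear map. -/
def symmOfUpperLin (m : ℕ) : UpperCoord m →ₗ[ℝ] Matrix (Fin m) (Fin m) ℝ where
  toFun := symmOfUpper m
  map_add' _ _ := rfl
  map_smul' _ _ := rfl

@[simp]
lemma symmOfUpperLin_apply (x : UpperCoord m) : symmOfUpperLin m x = symmOfUpper m x := rfl

/-- The entries on and above the diagonal. -/
def upperPart (m : ℕ) : Matrix (Fin m) (Fin m) ℝ →ₗ[ℝ] UpperCoord m where
  toFun A p := A p.1.1 p.1.2
  map_add' _ _ := rfl
  map_smul' _ _ := rfl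

@[simp]
lemma upperPart_apply (A : Matrix (Fin m) (Fin m) ℝ)
    (p : {p : Fin m × Fin m // p.1 ≤ p.2}) : upperPart m A p = A p.1.1 p.1.2 := rfl

lemma upperPart_symmOfUpper (x : UpperCoord m) : upperPart m (symmOfUpper m x) = x := by
  funext p
  obtain ⟨⟨i, j⟩, h⟩ := p
  have h' : i ≤ j := h
  simp [symmOfUpper, min_eq_left h', max_eq_right h']

lemma symmOfUpper_transpose (x : UpperCoord m) :
    (symmOfUpper m x)ᵀ = symmOfUpper m x := by
  ext i j
  simp [symmOfUpper, min_comm, max_comm]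

lemma symmOfUpper_upperPart {A : Matrix (Fin m) (Fin m) ℝ} (hA : Aᵀ = A) :
    symmOfUpper m (upperPart m A) = A := by
  ext i j
  rcases le_total i j with h | h
  · simp [symmOfUpper, h]
  · have := congrFun (congrFun hA i) j
    simpa [symmOfUpper, h] using this

lemma symmOfUpper_injective (m : ℕ) : Function.Injective (symmOfUpper m) :=
  Function.LeftInverse.injective upperPart_symmOfUpper

/-- The congruence `X ↦ Q X Qᵀ` of symmetric matrices, in coordinates. -/
def conjUpper (Q : Matrix (Fin m) (Fin m) ℝ) : UpperCoord m →ₗ[ℝ] UpperCoord m :=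
  upperPart m ∘ₗ LinearMap.mulLeftRight ℝ (Q, Qᵀ) ∘ₗ symmOfUpperLin m

lemma conjUpper_apply (Q : Matrix (Fin m) (Fin m) ℝ) (x : UpperCoord m) :
    conjUpper Q x = upperPart m (Q * symmOfUpper m x * Qᵀ) := rfl

lemma symmOfUpper_conjUpper (Q : Matrix (Fin m) (Fin m) ℝ) (x : UpperCoord m) :
    symmOfUpper m (conjUpper Q x) = Q * symmOfUpper m x * Qᵀ := by
  rw [conjUpper_apply, symmOfUpper_upperPart]
  simp [Matrix.transpose_mul, symmOfUpper_transpose, Matrix.mul_assoc]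

lemma conjUpper_mul (Q R : Matrix (Fin m) (Fin m) ℝ) :
    conjUpper (Q * R) = conjUpper Q ∘ₗ conjUpper R := by
  refine LinearMap.ext fun x => ?_
  apply symmOfUpper_injective
  simp [symmOfUpper_conjUpper, Matrix.transpose_mul, Matrix.mul_assoc]

lemma conjUpper_one : conjUpper (1 : Matrix (Fin m) (Fin m) ℝ) = LinearMap.id := by
  refine LinearMap.ext fun x => ?_
  apply symmOfUpper_injective
  simp [symmOfUpper_conjUpper]

/-- Counting `i` from zero, `d i` occurs `m - i` times as a row factor and `i + 1` times as a column
factor, hence `m + 1` times in all. -/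
lemma prod_upper_mul (d : Fin m → ℝ) :
    ∏ p : {p : Fin m × Fin m // p.1 ≤ p.2}, d p.1.1 * d p.1.2 = (∏ i, d i) ^ (m + 1) := by
  have h (f : Fin m × Fin m → ℝ) : ∏ p : {p : Fin m × Fin m // p.1 ≤ p.2}, f p.1
      = ∏ i, ∏ j, if i ≤ j then f (i, j) else 1 := by
    rw [← Finset.prod_subtype (Finset.univ.filter fun p : Fin m × Fin m => p.1 ≤ p.2) (by simp) f,
      Finset.prod_filter, Fintype.prod_prod_type]
  have h1 : ∏ p : {p : Fin m × Fin m // p.1 ≤ p.2}, d p.1.1 = ∏ i, d i ^ (m - (i : ℕ)) := by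
    rw [h fun p => d p.1]
    refine Finset.prod_congr rfl fun i _ => ?_
    simp only [← Finset.prod_filter, Finset.prod_const, Finset.filter_le_eq_Ici, Fin.card_Ici]
  have h2 : ∏ p : {p : Fin m × Fin m // p.1 ≤ p.2}, d p.1.2 = ∏ i, d i ^ ((i : ℕ) + 1) := by
    rw [h fun p => d p.2, Finset.prod_comm]
    refine Finset.prod_congr rfl fun i _ => ?_
    simp only [← Finset.prod_filter, Finset.prod_const, Finset.filter_ge_eq_Iic, Fin.card_Iic]
  rw [Finset.prod_mul_distrib, h1, h2, ← Finset.prod_mul_distrib, ← Finset.prod_pow]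
  refine Finset.prod_congr rfl fun i _ => ?_
  rw [← pow_add]
  congr 1
  have := i.2
  omega

lemma det_conjUpper_diagonal (d : Fin m → ℝ) :
    LinearMap.det (conjUpper (Matrix.diagonal d)) = (∏ i, d i) ^ (m + 1) := by
  have h : conjUpper (Matrix.diagonal d)
      = Matrix.toLin' (Matrix.diagonal fun p : {p : Fin m × Fin m // p.1 ≤ p.2} =>
          d p.1.1 * d p.1.2) := by
    refine LinearMap.ext fun x => ?_
    funext p
    obtain ⟨⟨i, j⟩, hp⟩ := p
    have h' : i ≤ j := hp
    simp [conjUpper_apply, Matrix.mulVec_diagonal, symmOfUpper, h']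
    ring
  rw [h, LinearMap.det_toLin', Matrix.det_diagonal, prod_upper_mul]

/-- The Jacobian determinant of a symmetric congruence on symmetric matrices. -/
lemma det_conjUpper {Q : Matrix (Fin m) (Fin m) ℝ} (hQ : Qᵀ = Q) :
    LinearMap.det (conjUpper Q) = Q.det ^ (m + 1) := by
  have hH : Q.IsHermitian := by
    rwa [Matrix.IsHermitian, Matrix.conjTranspose_eq_transpose_of_trivial]
  set U : Matrix (Fin m) (Fin m) ℝ := ↑hH.eigenvectorUnitary with hU
  have hUU : U * star U = 1 := Unitary.coe_mul_star_self hH.eigenvectorUnitary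
  have hs : Q = U * Matrix.diagonal hH.eigenvalues * star U := by
    simpa [Unitary.conjStarAlgAut_apply] using hH.spectral_theorem
  -- The orthogonal factors enter only through the product of their two determinants, which is `1`
  -- because `U * star U = 1`; only the diagonal factor remains.
  have h1 : LinearMap.det (conjUpper U) * LinearMap.det (conjUpper (star U)) = 1 := by
    rw [← LinearMap.det_comp, ← conjUpper_mul, hUU, conjUpper_one, LinearMap.det_id]
  have h2 : U.det * (star U).det = 1 := by rw [← Matrix.det_mul, hUU, Matrix.det_one]
  rw [hs, conjUpper_mul, conjUpper_mul, LinearMap.det_comp, LinearMap.det_comp,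
    det_conjUpper_diagonal, Matrix.det_mul, Matrix.det_mul, Matrix.det_diagonal, mul_right_comm, h1,
    mul_right_comm, h2, one_mul, one_mul]

/-! ### Measurability of the cone and changes of variables on it. -/

instance instBorelSpaceMatrix (m : ℕ) : BorelSpace (Matrix (Fin m) (Fin m) ℝ) :=
  inferInstanceAs (BorelSpace (Fin m → Fin m → ℝ))

lemma isClosed_posSemidef : IsClosed {A : Matrix (Fin m) (Fin m) ℝ | A.PosSemidef} := by
  simp only [Matrix.posSemidef_iff_dotProduct_mulVec, Set.ofPred_and, Set.ofPred_forall]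
  refine IsClosed.inter ?_ (isClosed_iInter fun x => ?_)
  · exact isClosed_eq (by fun_prop) continuous_id
  · exact isClosed_le continuous_const (by fun_prop)

lemma measurableSet_posDef : MeasurableSet {A : Matrix (Fin m) (Fin m) ℝ | A.PosDef} := by
  have h : {A : Matrix (Fin m) (Fin m) ℝ | A.PosDef} = {A | A.PosSemidef} ∩ {A | A.det ≠ 0} := by
    ext A
    exact ⟨fun h => ⟨h.posSemidef, h.det_pos.ne'⟩, fun h => h.1.posDef_iff_det_ne_zero.2 h.2⟩
  have h2 : IsOpen {A : Matrix (Fin m) (Fin m) ℝ | A.det ≠ 0} :=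
    isOpen_ne_fun (by fun_prop) continuous_const
  rw [h]
  exact isClosed_posSemidef.measurableSet.inter h2.measurableSet

lemma continuous_symmOfUpper : Continuous (symmOfUpper m) :=
  (symmOfUpperLin m).continuous_of_finiteDimensional

lemma continuous_upperPart : Continuous (upperPart m) :=
  (upperPart m).continuous_of_finiteDimensional

/-- The inverse `upperPart` is continuous and the range, the symmetric matrices, is closed.
Integrals against `symmVolume` can thus be moved to coordinates for arbitrary integrands. -/
lemma measurableEmbedding_symmOfUpper : MeasurableEmbedding (symmOfUpper m) := by
  refine MeasurableEmbedding.of_measurable_inverse continuous_symmOfUpper.measurable ?_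
    continuous_upperPart.measurable upperPart_symmOfUpper
  have : Set.range (symmOfUpper m) = {A | Aᵀ = A} := by
    ext A
    constructor
    · rintro ⟨x, rfl⟩
      exact symmOfUpper_transpose x
    · exact fun h => ⟨_, symmOfUpper_upperPart h⟩
  rw [this]
  exact (isClosed_eq (by fun_prop) continuous_id).measurableSet

instance instSFiniteSymmVolume : SFinite (symmVolume m) :=
  inferInstanceAs (SFinite (Measure.map (symmOfUpper m) volume))

lemma transpose_eq_of_posDef {A : Matrix (Fin m) (Fin m) ℝ} (hA : A.PosDef) : Aᵀ = A := by
  simpa [Matrix.IsHermitian] using hA.isHermitian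

lemma setLIntegral_symmVolume (f : Matrix (Fin m) (Fin m) ℝ → ℝ≥0∞)
    (s : Set (Matrix (Fin m) (Fin m) ℝ)) :
    ∫⁻ A in s, f A ∂symmVolume m = ∫⁻ x in symmOfUpper m ⁻¹' s, f (symmOfUpper m x) := by
  rw [symmVolume, measurableEmbedding_symmOfUpper.restrict_map,
    measurableEmbedding_symmOfUpper.lintegral_map]

/-- Translation invariance of Lebesgue measure on symmetric matrices. -/
lemma setLIntegral_preimage_add_right {B : Matrix (Fin m) (Fin m) ℝ} (hB : Bᵀ = B)
    (f : Matrix (Fin m) (Fin m) ℝ → ℝ≥0∞) {s : Set (Matrix (Fin m) (Fin m) ℝ)}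
    (hs : MeasurableSet s) :
    ∫⁻ A in (· + B) ⁻¹' s, f (A + B) ∂symmVolume m = ∫⁻ A in s, f A ∂symmVolume m := by
  have hs' : MeasurableSet ((· + B) ⁻¹' s) := (continuous_add_const B).measurable hs
  rw [← lintegral_indicator hs', ← lintegral_indicator hs, symmVolume,
    measurableEmbedding_symmOfUpper.lintegral_map, measurableEmbedding_symmOfUpper.lintegral_map,
    ← lintegral_add_right_eq_self (fun x => s.indicator f (symmOfUpper m x)) (upperPart m B)]
  refine lintegral_congr fun x => ?_
  have : symmOfUpper m (x + upperPart m B) = symmOfUpper m x + B := by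
    conv_rhs => rw [← symmOfUpper_upperPart hB]
    exact (symmOfUpperLin m).map_add _ _
  rw [this]
  rfl

/-- Change of variables on the cone of positive definite matrices, in coordinates. -/
lemma setLIntegral_posDef_change {F : Matrix (Fin m) (Fin m) ℝ → Matrix (Fin m) (Fin m) ℝ}
    (F' : Matrix (Fin m) (Fin m) ℝ → UpperCoord m →L[ℝ] UpperCoord m)
    (hF' : ∀ x : UpperCoord m, (symmOfUpper m x).PosDef →
      HasFDerivAt (fun y => upperPart m (F (symmOfUpper m y))) (F' (symmOfUpper m x)) x)
    (hF : Set.BijOn F {A | A.PosDef} {A | A.PosDef})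
    (f : Matrix (Fin m) (Fin m) ℝ → ℝ≥0∞) :
    ∫⁻ A in {A | A.PosDef}, f A ∂symmVolume m
      = ∫⁻ A in {A | A.PosDef}, ENNReal.ofReal |(F' A).det| * f (F A) ∂symmVolume m := by
  have hsu {A : Matrix (Fin m) (Fin m) ℝ} (hA : A.PosDef) :
      symmOfUpper m (upperPart m A) = A := symmOfUpper_upperPart (transpose_eq_of_posDef hA)
  set S : Set (UpperCoord m) := symmOfUpper m ⁻¹' {A | A.PosDef} with hS
  have hSm : MeasurableSet S := continuous_symmOfUpper.measurable measurableSet_posDef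
  have himg : (fun y => upperPart m (F (symmOfUpper m y))) '' S = S := by
    ext x
    constructor
    · rintro ⟨y, hy, rfl⟩
      have := hF.mapsTo hy
      simpa only [hS, Set.mem_preimage, hsu this] using this
    · intro hx
      obtain ⟨A, hA, hAx⟩ := hF.surjOn hx
      refine ⟨upperPart m A, ?_, ?_⟩
      · simpa only [hS, Set.mem_preimage, hsu hA] using hA
      · simp only [hsu hA, hAx, upperPart_symmOfUpper]
  have hinj : Set.InjOn (fun y => upperPart m (F (symmOfUpper m y))) S := by
    intro x hx y hy hxy
    have h := congrArg (symmOfUpper m) hxy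
    simp only [hsu (hF.mapsTo hx), hsu (hF.mapsTo hy)] at h
    exact symmOfUpper_injective m (hF.injOn hx hy h)
  rw [setLIntegral_symmVolume, setLIntegral_symmVolume, ← hS]
  conv_lhs => rw [← himg]
  rw [lintegral_image_eq_lintegral_abs_det_fderiv_mul volume hSm
    (fun x hx => (hF' x hx).hasFDerivWithinAt) hinj]
  refine setLIntegral_congr_fun hSm fun x hx => ?_
  simp only [hsu (hF.mapsTo hx)]

lemma posDef_conj {Q A : Matrix (Fin m) (Fin m) ℝ} (hQ : Qᵀ = Q) (hQu : IsUnit Q.det) :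
    (Q * A * Q).PosDef ↔ A.PosDef := by
  have := Matrix.IsUnit.posDef_star_right_conjugate_iff (x := A)
    ((Matrix.isUnit_iff_isUnit_det Q).2 hQu)
  rwa [Matrix.star_eq_conjTranspose, Matrix.conjTranspose_eq_transpose_of_trivial, hQ] at this

lemma bijOn_conj {Q : Matrix (Fin m) (Fin m) ℝ} (hQ : Qᵀ = Q) (hQu : IsUnit Q.det) :
    Set.BijOn (fun A => Q * A * Q) {A | A.PosDef} {A | A.PosDef} := by
  have h1 (A : Matrix (Fin m) (Fin m) ℝ) : Q⁻¹ * (Q * A * Q) * Q⁻¹ = A := by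
    rw [Matrix.mul_assoc Q, Matrix.nonsing_inv_mul_cancel_left _ _ hQu,
      Matrix.mul_nonsing_inv_cancel_right _ _ hQu]
  have h2 (A : Matrix (Fin m) (Fin m) ℝ) : Q * (Q⁻¹ * A * Q⁻¹) * Q = A := by
    rw [Matrix.mul_assoc Q⁻¹, Matrix.mul_nonsing_inv_cancel_left _ _ hQu,
      Matrix.nonsing_inv_mul_cancel_right _ _ hQu]
  refine ⟨fun A hA => (posDef_conj hQ hQu).2 hA, fun A _ B _ h => ?_, fun A hA => ?_⟩
  · rw [← h1 A, ← h1 B]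
    exact congrArg (fun X => Q⁻¹ * X * Q⁻¹) h
  · refine ⟨Q⁻¹ * A * Q⁻¹, ?_, h2 A⟩
    rw [Set.mem_ofPred_eq, ← posDef_conj hQ hQu, h2]
    exact hA

/-- The substitution `A = Q X Q` on positive definite matrices, `Q` symmetric. -/
lemma setLIntegral_posDef_conj {Q : Matrix (Fin m) (Fin m) ℝ} (hQ : Qᵀ = Q)
    (hQu : IsUnit Q.det) (f : Matrix (Fin m) (Fin m) ℝ → ℝ≥0∞) :
    ∫⁻ A in {A | A.PosDef}, f A ∂symmVolume m
      = ENNReal.ofReal (|Q.det| ^ (m + 1))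
        * ∫⁻ A in {A | A.PosDef}, f (Q * A * Q) ∂symmVolume m := by
  rw [setLIntegral_posDef_change (F := fun A => Q * A * Q)
    (fun _ => LinearMap.toContinuousLinearMap (conjUpper Q)) (fun x _ => ?_) (bijOn_conj hQ hQu),
    lintegral_const_mul' _ _ ENNReal.ofReal_ne_top]
  · rw [← abs_pow, ← det_conjUpper hQ]
    rfl
  · have h : (fun y => upperPart m (Q * symmOfUpper m y * Q))
        = LinearMap.toContinuousLinearMap (conjUpper Q) := by
      funext y
      simp [conjUpper_apply, hQ]
    simp only [h]
    exact ContinuousLinearMap.hasFDerivAt _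

section Inverse

open scoped Matrix.Norms.L2Operator

/-- The derivative of inversion at `X` is `H ↦ -X⁻¹ H X⁻¹`, which is minus a congruence, so
`det_conjUpper` also yields this Jacobian. The operator norm serves only to make matrices a normed
algebra. -/
lemma hasFDerivAt_upperPart_inv {x : UpperCoord m} (hx : (symmOfUpper m x).PosDef) :
    HasFDerivAt (fun y => upperPart m (symmOfUpper m y)⁻¹)
      (LinearMap.toContinuousLinearMap (-conjUpper (symmOfUpper m x)⁻¹)) x := by
  obtain ⟨u, hu⟩ := hx.isUnit
  have h1 := hasFDerivAt_ringInverse (𝕜 := ℝ) u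
  rw [hu] at h1
  have h2 := (LinearMap.toContinuousLinearMap (upperPart m)).hasFDerivAt.comp x
    (h1.comp x (LinearMap.toContinuousLinearMap (symmOfUpperLin m)).hasFDerivAt (f := symmOfUpper m))
  have hi : (↑u⁻¹ : Matrix (Fin m) (Fin m) ℝ) = (symmOfUpper m x)⁻¹ := by
    rw [← hu, Matrix.coe_units_inv]
  have hfun : (fun y => upperPart m (symmOfUpper m y)⁻¹)
      = LinearMap.toContinuousLinearMap (upperPart m) ∘ Ring.inverse ∘ symmOfUpper m := by
    funext y
    simp [Matrix.nonsing_inv_eq_ringInverse]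
  rw [hfun]
  refine h2.congr_fderiv (ContinuousLinearMap.ext fun y => ?_)
  simp [conjUpper_apply, hi, Matrix.transpose_nonsing_inv, symmOfUpper_transpose,
    Matrix.mul_assoc]

end Inverse

/-- The substitution `A = X⁻¹` on positive definite matrices. -/
lemma setLIntegral_posDef_inv (f : Matrix (Fin m) (Fin m) ℝ → ℝ≥0∞) :
    ∫⁻ A in {A | A.PosDef}, f A ∂symmVolume m
      = ∫⁻ A in {A | A.PosDef}, ENNReal.ofReal ((A.det)⁻¹ ^ (m + 1)) * f A⁻¹ ∂symmVolume m := by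
  rw [setLIntegral_posDef_change (F := fun A => A⁻¹)
    (fun A => LinearMap.toContinuousLinearMap (-conjUpper A⁻¹))
    (fun x hx => hasFDerivAt_upperPart_inv hx)]
  · refine setLIntegral_congr_fun measurableSet_posDef fun A hA => ?_
    have hA : A.PosDef := hA
    have hT : (A⁻¹)ᵀ = A⁻¹ := transpose_eq_of_posDef hA.inv
    have h : |(LinearMap.toContinuousLinearMap (-conjUpper A⁻¹)).det| = A.det⁻¹ ^ (m + 1) := by
      change |LinearMap.det (-conjUpper A⁻¹)| = _
      -- The sign `(-1)^dim` disappears under the absolute value.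
      rw [← neg_one_smul ℝ, LinearMap.det_smul, det_conjUpper hT, abs_mul, abs_pow, abs_neg,
        abs_one, one_pow, one_mul, Matrix.det_nonsing_inv, Ring.inverse_eq_inv', abs_of_pos]
      exact pow_pos (inv_pos.2 hA.det_pos) _
    simp only [h]
  · refine ⟨fun A hA => Matrix.PosDef.inv hA, fun A hA B hB h => ?_, fun A hA => ?_⟩
    · have := congrArg (·⁻¹) h
      simpa [Matrix.nonsing_inv_nonsing_inv _ (isUnit_iff_ne_zero.2 (Matrix.PosDef.det_pos hA).ne'),
        Matrix.nonsing_inv_nonsing_inv _ (isUnit_iff_ne_zero.2 (Matrix.PosDef.det_pos hB).ne')]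
        using this
    · exact ⟨A⁻¹, Matrix.PosDef.inv hA,
        Matrix.nonsing_inv_nonsing_inv _ (isUnit_iff_ne_zero.2 (Matrix.PosDef.det_pos hA).ne')⟩

/-! ### Bordered matrices and the Schur complement. -/

/-- The positions `(i, j)`, `i ≤ j`, of an `(m + 1) × (m + 1)` matrix: the first row, and the
positions of the lower right `m × m` block. -/
def borderIndex (m : ℕ) :
    Fin (m + 1) ⊕ {p : Fin m × Fin m // p.1 ≤ p.2} ≃
      {p : Fin (m + 1) × Fin (m + 1) // p.1 ≤ p.2} :=
  Equiv.ofBijective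
    (Sum.elim (fun j => ⟨(0, j), Fin.zero_le j⟩)
      fun p => ⟨(p.1.1.succ, p.1.2.succ), Fin.succ_le_succ_iff.2 p.2⟩) (by
    constructor
    · rintro (i | ⟨⟨i, j⟩, h⟩) (k | ⟨⟨k, l⟩, h'⟩) hik
      · simpa using hik
      · simp [Subtype.ext_iff, (Fin.succ_ne_zero _).symm] at hik
      · simp [Subtype.ext_iff] at hik
      · simpa [Subtype.ext_iff] using hik
    · rintro ⟨⟨i, j⟩, h⟩
      have h : i ≤ j := h
      cases i using Fin.cases with
      | zero => exact ⟨Sum.inl j, rfl⟩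
      | succ i =>
        cases j using Fin.cases with
        | zero => simp at h
        | succ j => exact ⟨Sum.inr ⟨(i, j), Fin.succ_le_succ_iff.1 h⟩, rfl⟩)

/-- Coordinates of the symmetric matrix with upper left entry `t`, remaining first row `x` and
lower right block with coordinates `y`. -/
def borderUpper (t : ℝ) (x : Fin m → ℝ) (y : UpperCoord m) : UpperCoord (m + 1) :=
  fun p => Sum.elim (Fin.cons t x : Fin (m + 1) → ℝ) y ((borderIndex m).symm p)

lemma borderUpper_zero (t : ℝ) (x : Fin m → ℝ) (y : UpperCoord m) (j : Fin (m + 1)) (h : 0 ≤ j) :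
    borderUpper t x y ⟨(0, j), h⟩ = (Fin.cons t x : Fin (m + 1) → ℝ) j := by
  have : (borderIndex m).symm ⟨(0, j), h⟩ = Sum.inl j := by
    rw [Equiv.symm_apply_eq]; rfl
  rw [borderUpper, this, Sum.elim_inl]

lemma borderUpper_succ (t : ℝ) (x : Fin m → ℝ) (y : UpperCoord m) (i j : Fin m)
    (h : i.succ ≤ j.succ) :
    borderUpper t x y ⟨(i.succ, j.succ), h⟩ = y ⟨(i, j), Fin.succ_le_succ_iff.1 h⟩ := by
  have : (borderIndex m).symm ⟨(i.succ, j.succ), h⟩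
      = Sum.inr ⟨(i, j), Fin.succ_le_succ_iff.1 h⟩ := by
    rw [Equiv.symm_apply_eq]; rfl
  rw [borderUpper, this, Sum.elim_inr]

/-- Reindexing by `borderIndex` and splitting off the corner entry preserve Lebesgue measure;
Tonelli does the rest. -/
lemma lintegral_upperCoord_succ {g : UpperCoord (m + 1) → ℝ≥0∞} (hg : Measurable g) :
    ∫⁻ z, g z = ∫⁻ t : ℝ, ∫⁻ x : Fin m → ℝ, ∫⁻ y : UpperCoord m, g (borderUpper t x y) := by
  have h1 := (volume_measurePreserving_piCongrLeft (fun _ => ℝ) (borderIndex m)).symm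
  have h2 := volume_measurePreserving_sumPiEquivProdPi_symm
    (fun _ : Fin (m + 1) ⊕ {p : Fin m × Fin m // p.1 ≤ p.2} => ℝ)
  have h3 := volume_preserving_piFinSuccAbove (fun _ : Fin (m + 1) => ℝ) 0
  have h4 : MeasurePreserving (MeasurableEquiv.prodCongr
      (MeasurableEquiv.piFinSuccAbove (fun _ : Fin (m + 1) => ℝ) 0).symm
      (MeasurableEquiv.refl (UpperCoord m))) volume volume :=
    h3.symm.prod (MeasurePreserving.id (volume : Measure (UpperCoord m)))
  have hmeas : Measurable fun q : (ℝ × (Fin m → ℝ)) × UpperCoord m =>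
      g (borderUpper q.1.1 q.1.2 q.2) := by
    refine hg.comp (measurable_pi_iff.2 fun p => ?_)
    unfold borderUpper
    rcases (borderIndex m).symm p with j | j
    · cases j using Fin.cases with
      | zero => simpa using measurable_fst.fst
      | succ j => exact (measurable_pi_apply j).comp measurable_fst.snd
    · exact (measurable_pi_apply j).comp measurable_snd
  have key : ∫⁻ z, g z = ∫⁻ q : (ℝ × (Fin m → ℝ)) × UpperCoord m,
      g (borderUpper q.1.1 q.1.2 q.2) := by
    rw [← h1.symm.lintegral_comp_emb (MeasurableEquiv.measurableEmbedding _),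
      ← h2.lintegral_comp_emb (MeasurableEquiv.measurableEmbedding _),
      ← h4.lintegral_comp_emb (MeasurableEquiv.measurableEmbedding _)]
    refine lintegral_congr fun q => ?_
    congr 1
    funext p
    obtain ⟨i, rfl⟩ := (borderIndex m).surjective p
    rw [MeasurableEquiv.symm_symm, MeasurableEquiv.piCongrLeft_apply_apply, borderUpper,
      Equiv.symm_apply_apply]
    rcases i with j | j
    · cases j using Fin.cases <;> rfl
    · rfl
  rw [key, Measure.volume_eq_prod, lintegral_prod _ hmeas.aemeasurable, Measure.volume_eq_prod,
    lintegral_prod _ hmeas.lintegral_prod_right'.aemeasurable]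

/-- The Schur complement of the upper left entry. -/
def schurBorder (t : ℝ) (x : Fin m → ℝ) (D : Matrix (Fin m) (Fin m) ℝ) :
    Matrix (Fin m) (Fin m) ℝ :=
  D - t⁻¹ • Matrix.vecMulVec x x

lemma sub_mul_eq_schurBorder (t : ℝ) (x : Fin m → ℝ) (D : Matrix (Fin m) (Fin m) ℝ) :
    D - (Matrix.replicateRow Unit x)ᴴ * (Matrix.diagonal fun _ : Unit => t)⁻¹
      * Matrix.replicateRow Unit x = schurBorder t x D := by
  ext i j
  simp [schurBorder, Matrix.mul_apply, Matrix.vecMulVec_apply]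
  ring

lemma submatrix_borderUpper (t : ℝ) (x : Fin m → ℝ) (y : UpperCoord m) :
    (symmOfUpper (m + 1) (borderUpper t x y)).submatrix
        (Sum.elim (fun _ : Unit => 0) Fin.succ) (Sum.elim (fun _ : Unit => 0) Fin.succ)
      = Matrix.fromBlocks (Matrix.diagonal fun _ => t) (Matrix.replicateRow Unit x)
        (Matrix.replicateRow Unit x)ᴴ (symmOfUpper m y) := by
  ext (i | i) (j | j)
  · simp [symmOfUpper, borderUpper_zero]
  · simp [symmOfUpper, borderUpper_zero]
  · simp [symmOfUpper, borderUpper_zero]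
  · simp only [symmOfUpper, Matrix.submatrix_apply, Sum.elim_inr, Matrix.of_apply,
      Matrix.fromBlocks_apply₂₂]
    rcases le_total i j with h | h
    · simp [h, borderUpper_succ]
    · simp [h, borderUpper_succ]

lemma det_borderUpper {t : ℝ} (ht : t ≠ 0) (x : Fin m → ℝ) (y : UpperCoord m) :
    (symmOfUpper (m + 1) (borderUpper t x y)).det
      = t * (schurBorder t x (symmOfUpper m y)).det := by
  let e : Unit ⊕ Fin m ≃ Fin (m + 1) := Equiv.ofBijective
    (Sum.elim (fun _ : Unit => 0) Fin.succ) (by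
      constructor
      · rintro (i | i) (j | j) h <;> simp_all [(Fin.succ_ne_zero _).symm]
      · intro i
        cases i using Fin.cases with
        | zero => exact ⟨Sum.inl (), rfl⟩
        | succ i => exact ⟨Sum.inr i, rfl⟩)
  have h := Matrix.det_submatrix_equiv_self e (symmOfUpper (m + 1) (borderUpper t x y))
  have hi : Invertible (Matrix.diagonal fun _ : Unit => t) :=
    Matrix.invertibleOfIsUnitDet _ (by simpa using ht)
  rw [← h]
  change ((symmOfUpper (m + 1) (borderUpper t x y)).submatrix
        (Sum.elim (fun _ : Unit => 0) Fin.succ) (Sum.elim (fun _ : Unit => 0) Fin.succ)).det = _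
  rw [submatrix_borderUpper, Matrix.det_fromBlocks₁₁, Matrix.invOf_eq_nonsing_inv]
  rw [sub_mul_eq_schurBorder]
  simp

/-- Only this direction of the Schur criterion is needed, since the gamma integral is to be bounded
from above. -/
lemma posDef_borderUpper {t : ℝ} {x : Fin m → ℝ} {y : UpperCoord m}
    (h : (symmOfUpper (m + 1) (borderUpper t x y)).PosDef) :
    0 < t ∧ (schurBorder t x (symmOfUpper m y)).PosDef := by
  have ht : 0 < t := by
    have := h.diag_pos (i := 0)
    simpa [symmOfUpper, borderUpper_zero] using this
  refine ⟨ht, ?_⟩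
  have hd := h.det_pos
  rw [det_borderUpper ht.ne'] at hd
  have hi : Invertible (Matrix.diagonal fun _ : Unit => t) :=
    Matrix.invertibleOfIsUnitDet _ (by simpa using ht.ne')
  have hs := h.posSemidef.submatrix
    (Sum.elim (fun _ : Unit => 0) Fin.succ : Unit ⊕ Fin m → Fin (m + 1))
  rw [submatrix_borderUpper, Matrix.PosDef.fromBlocks₁₁ _ _ (Matrix.PosDef.diagonal fun _ => ht)] at hs
  rw [sub_mul_eq_schurBorder] at hs
  -- The block criterion gives a semidefinite Schur complement; the nonzero determinant makes it
  -- definite.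
  exact hs.posDef_iff_det_ne_zero.2 fun h0 => by simp [h0] at hd

lemma trace_borderUpper (t : ℝ) (x : Fin m → ℝ) (y : UpperCoord m) :
    (symmOfUpper (m + 1) (borderUpper t x y)).trace
      = t + t⁻¹ * (x ⬝ᵥ x) + (schurBorder t x (symmOfUpper m y)).trace := by
  have : (symmOfUpper (m + 1) (borderUpper t x y)).trace = t + (symmOfUpper m y).trace := by
    rw [Matrix.trace, Fin.sum_univ_succ]
    simp [symmOfUpper, borderUpper_zero, borderUpper_succ, Matrix.trace]
  rw [this, schurBorder, Matrix.trace_sub, Matrix.trace_smul, Matrix.trace_vecMulVec]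
  simp

/-! ### Finiteness and positivity of the multivariate gamma function. -/

lemma measurable_matrix_det : Measurable fun A : Matrix (Fin m) (Fin m) ℝ => A.det :=
  (continuous_id.matrix_det).measurable

lemma measurable_matrix_trace : Measurable fun A : Matrix (Fin m) (Fin m) ℝ => A.trace :=
  (continuous_id.matrix_trace).measurable

/-- The integrand `etr(-A) |A|^{a - (m + 1) / 2}` of the multivariate gamma function. -/
def gammaKernel (m : ℕ) (a : ℝ) (A : Matrix (Fin m) (Fin m) ℝ) : ℝ :=
  Real.exp (-A).trace * A.det ^ (a - ((m : ℝ) + 1) / 2)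

lemma measurable_gammaKernel (a : ℝ) : Measurable (gammaKernel m a) := by
  refine Measurable.mul ?_ (measurable_matrix_det.pow_const _)
  simp only [Matrix.trace_neg]
  exact measurable_matrix_trace.neg.exp

lemma gammaKernel_pos {A : Matrix (Fin m) (Fin m) ℝ} (hA : A.PosDef) (a : ℝ) :
    0 < gammaKernel m a A :=
  mul_pos (Real.exp_pos _) (Real.rpow_pos_of_pos hA.det_pos _)

/-- The multivariate gamma integral with values in `[0, ∞]`. -/
def gammaLIntegral (m : ℕ) (a : ℝ) : ℝ≥0∞ :=
  ∫⁻ A in {A : Matrix (Fin m) (Fin m) ℝ | A.PosDef}, ENNReal.ofReal (gammaKernel m a A)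
    ∂symmVolume m

lemma multivariateGamma_eq_toReal (m : ℕ) (a : ℝ) :
    multivariateGamma m a = (gammaLIntegral m a).toReal := by
  refine integral_eq_lintegral_of_nonneg_ae ?_ (measurable_gammaKernel a).aestronglyMeasurable
  filter_upwards [ae_restrict_mem measurableSet_posDef] with A hA
  exact (gammaKernel_pos hA a).le

/-- Determinant and trace both split along the Schur complement. The exponent `a - (m + 2) / 2` is
the one belonging to size `m` and parameter `a - 1 / 2`. -/
lemma gammaKernel_borderUpper {t : ℝ} {x : Fin m → ℝ} {y : UpperCoord m}
    (h : (symmOfUpper (m + 1) (borderUpper t x y)).PosDef) (a : ℝ) :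
    gammaKernel (m + 1) a (symmOfUpper (m + 1) (borderUpper t x y))
      = Real.exp (-t) * t ^ (a - ((m : ℝ) + 2) / 2) * Real.exp (-t⁻¹ * (x ⬝ᵥ x))
        * gammaKernel m (a - 1 / 2) (schurBorder t x (symmOfUpper m y)) := by
  obtain ⟨ht, hS⟩ := posDef_borderUpper h
  rw [gammaKernel, gammaKernel, det_borderUpper ht.ne', Matrix.trace_neg, Matrix.trace_neg,
    trace_borderUpper, Real.mul_rpow ht.le hS.det_pos.le, neg_add, neg_add, Real.exp_add,
    Real.exp_add, show a - (((m + 1 : ℕ) : ℝ) + 1) / 2 = a - ((m : ℝ) + 2) / 2 by push_cast; ring,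
    show a - 1 / 2 - ((m : ℝ) + 1) / 2 = a - ((m : ℝ) + 2) / 2 by ring, neg_mul]
  ring

lemma lintegral_exp_neg_mul_dotProduct {s : ℝ} (hs : 0 < s) :
    ∫⁻ x : Fin m → ℝ, ENNReal.ofReal (Real.exp (-s * (x ⬝ᵥ x)))
      = ENNReal.ofReal (√(Real.pi / s) ^ m) := by
  have h (x : Fin m → ℝ) : Real.exp (-s * (x ⬝ᵥ x)) = ∏ i, Real.exp (-s * x i ^ 2) := by
    rw [← Real.exp_sum, dotProduct, Finset.mul_sum]
    simp only [sq]
  simp only [h]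
  rw [← ofReal_integral_eq_lintegral_ofReal,
    integral_fintype_prod_volume_eq_pow (ι := Fin m) fun r : ℝ => Real.exp (-s * r ^ 2),
    integral_gaussian, Fintype.card_fin]
  · exact Integrable.fintype_prod fun _ => integrable_exp_neg_mul_sq hs
  · exact Filter.Eventually.of_forall fun x => Finset.prod_nonneg fun i _ => (Real.exp_pos _).le

/-- For fixed `t` and `x` the Schur complement is a translate of the lower block, and Lebesgue
measure is translation invariant. -/
lemma lintegral_schurBorder (t : ℝ) (x : Fin m → ℝ) (a : ℝ) :
    ∫⁻ y : UpperCoord m, {A : Matrix (Fin m) (Fin m) ℝ | A.PosDef}.indicator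
        (fun A => ENNReal.ofReal (gammaKernel m a A)) (schurBorder t x (symmOfUpper m y))
      = gammaLIntegral m a := by
  have hT : (t⁻¹ • Matrix.vecMulVec x x)ᵀ = t⁻¹ • Matrix.vecMulVec x x := by
    ext i j
    simp [Matrix.vecMulVec_apply, mul_comm]
  rw [gammaLIntegral, setLIntegral_symmVolume, ← lintegral_indicator
    (continuous_symmOfUpper.measurable measurableSet_posDef),
    ← lintegral_sub_right_eq_self ((symmOfUpper m ⁻¹' {A | A.PosDef}).indicator _)
      (upperPart m (t⁻¹ • Matrix.vecMulVec x x))]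
  refine lintegral_congr fun y => ?_
  have : symmOfUpper m (y - upperPart m (t⁻¹ • Matrix.vecMulVec x x))
      = schurBorder t x (symmOfUpper m y) := by
    rw [schurBorder]
    conv_rhs => rw [← symmOfUpper_upperPart hT]
    exact (symmOfUpperLin m).map_sub _ _
  rw [← this]
  rfl

/-- One half of the recursion `Γ_{m+1}[a] = π^{m/2} Γ(a) Γ_m[a - 1/2]`; the inequality suffices for
convergence. -/
lemma gammaLIntegral_succ_le (m : ℕ) (a : ℝ) :
    gammaLIntegral (m + 1) a
      ≤ ∫⁻ t in Set.Ioi (0 : ℝ), ENNReal.ofReal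
          (√Real.pi ^ m * (Real.exp (-t) * t ^ (a - 1))) * gammaLIntegral m (a - 1 / 2) := by
  have hm : Measurable ((symmOfUpper (m + 1) ⁻¹' {A | A.PosDef}).indicator fun z =>
      ENNReal.ofReal (gammaKernel (m + 1) a (symmOfUpper (m + 1) z))) :=
    (((measurable_gammaKernel a).comp continuous_symmOfUpper.measurable).ennreal_ofReal).indicator
      (continuous_symmOfUpper.measurable measurableSet_posDef)
  rw [gammaLIntegral, setLIntegral_symmVolume, ← lintegral_indicator
    (continuous_symmOfUpper.measurable measurableSet_posDef), lintegral_upperCoord_succ hm,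
    ← lintegral_indicator measurableSet_Ioi]
  refine lintegral_mono fun t => ?_
  have hb (x : Fin m → ℝ) (y : UpperCoord m) :
      (symmOfUpper (m + 1) ⁻¹' {A | A.PosDef}).indicator (fun z =>
        ENNReal.ofReal (gammaKernel (m + 1) a (symmOfUpper (m + 1) z))) (borderUpper t x y)
      ≤ (Set.Ioi (0 : ℝ)).indicator (fun t => ENNReal.ofReal
          (Real.exp (-t) * t ^ (a - ((m : ℝ) + 2) / 2) * Real.exp (-t⁻¹ * (x ⬝ᵥ x)))) t
        * {A : Matrix (Fin m) (Fin m) ℝ | A.PosDef}.indicator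
        (fun A => ENNReal.ofReal (gammaKernel m (a - 1 / 2) A))
          (schurBorder t x (symmOfUpper m y)) := by
    by_cases h : (symmOfUpper (m + 1) (borderUpper t x y)).PosDef
    swap
    · exact (Set.indicator_of_notMem (by exact h) _).trans_le zero_le
    rw [Set.indicator_of_mem (by exact h)]
    obtain ⟨ht, hS⟩ := posDef_borderUpper h
    rw [Set.indicator_of_mem (Set.mem_Ioi.2 ht), Set.indicator_of_mem (by exact hS),
      gammaKernel_borderUpper h, ENNReal.ofReal_mul (by positivity)]
  refine (lintegral_mono fun x => lintegral_mono fun y => hb x y).trans ?_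
  by_cases ht : t ∈ Set.Ioi (0 : ℝ)
  · have ht0 : 0 < t := ht
    simp only [Set.indicator_of_mem ht]
    have h1 (x : Fin m → ℝ) : ∫⁻ y : UpperCoord m, ENNReal.ofReal
          (Real.exp (-t) * t ^ (a - ((m : ℝ) + 2) / 2) * Real.exp (-t⁻¹ * (x ⬝ᵥ x)))
        * {A : Matrix (Fin m) (Fin m) ℝ | A.PosDef}.indicator
          (fun A => ENNReal.ofReal (gammaKernel m (a - 1 / 2) A))
          (schurBorder t x (symmOfUpper m y))
        = ENNReal.ofReal (Real.exp (-t) * t ^ (a - ((m : ℝ) + 2) / 2))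
          * gammaLIntegral m (a - 1 / 2) * ENNReal.ofReal (Real.exp (-t⁻¹ * (x ⬝ᵥ x))) := by
      rw [lintegral_const_mul' _ _ ENNReal.ofReal_ne_top, lintegral_schurBorder,
        ENNReal.ofReal_mul (by positivity)]
      ring
    simp only [h1]
    rw [lintegral_const_mul _ (by fun_prop), lintegral_exp_neg_mul_dotProduct (inv_pos.2 ht0),
      mul_right_comm, ← ENNReal.ofReal_mul (by positivity)]
    refine le_of_eq (congrArg (fun r => ENNReal.ofReal r * gammaLIntegral m (a - 1 / 2)) ?_)
    -- The Gaussian integral over `x` equals `(π t)^{m/2}`, which raises the exponent of `t` from `a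
    -- - (m + 2) / 2` to `a - 1`.
    rw [div_inv_eq_mul, Real.sqrt_mul Real.pi_pos.le, mul_pow, Real.sqrt_eq_rpow t,
      ← Real.rpow_natCast (t ^ _), ← Real.rpow_mul ht0.le,
      show a - 1 = (a - ((m : ℝ) + 2) / 2) + 1 / 2 * (m : ℝ) by ring, Real.rpow_add ht0]
    ring
  · simp [Set.indicator_of_notMem ht]

/-- Convergence of the multivariate gamma integral. -/
lemma gammaLIntegral_lt_top : ∀ {m : ℕ} {a : ℝ}, ((m : ℝ) - 1) / 2 < a → gammaLIntegral m a < ∞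
  | 0, a, _ => by
    -- For `m = 0` the coordinate space is a single point of mass one and the kernel is `1`.
    rw [gammaLIntegral, setLIntegral_symmVolume]
    refine (lintegral_mono (g := fun _ => 1) fun x => ?_).trans_lt ?_
    · simp [gammaKernel]
    · rw [lintegral_one]
      exact (measure_mono (Set.subset_univ _)).trans_lt (by simp [volume_pi])
  | m + 1, a, h => by
    push_cast at h
    refine (gammaLIntegral_succ_le m a).trans_lt ?_
    have ih : gammaLIntegral m (a - 1 / 2) < ∞ := gammaLIntegral_lt_top (by linarith)
    have ha : 0 < a := by
      have : (0 : ℝ) ≤ m := m.cast_nonneg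
      linarith
    rw [lintegral_mul_const _ (by fun_prop)]
    refine ENNReal.mul_lt_top ?_ ih
    exact ((Real.GammaIntegral_convergent ha).const_mul _).lintegral_lt_top

lemma exists_posDef_add_natCast {A : Matrix (Fin m) (Fin m) ℝ} (hA : Aᵀ = A) :
    ∃ n : ℕ, (A + (n : ℝ) • 1).PosDef := by
  have hH : A.IsHermitian := by
    rwa [Matrix.IsHermitian, Matrix.conjTranspose_eq_transpose_of_trivial]
  obtain ⟨n, hn⟩ := exists_nat_gt (∑ i, |hH.eigenvalues i|)
  refine ⟨n, ?_⟩
  have hpos (i : Fin m) : 0 < hH.eigenvalues i + n := by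
    have h1 := Finset.single_le_sum (f := fun i => |hH.eigenvalues i|)
      (fun i _ => abs_nonneg _) (Finset.mem_univ i)
    have h2 := neg_abs_le (hH.eigenvalues i)
    linarith
  have hs := hH.spectral_theorem
  set U : Matrix (Fin m) (Fin m) ℝ := ↑hH.eigenvectorUnitary with hU
  have hUU : U * star U = 1 := Unitary.coe_mul_star_self hH.eigenvectorUnitary
  have he : A + (n : ℝ) • 1
      = U * Matrix.diagonal (fun i => hH.eigenvalues i + n) * star U := by
    have hd : Matrix.diagonal (fun i => hH.eigenvalues i + n)
        = Matrix.diagonal hH.eigenvalues + (n : ℝ) • 1 := by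
      rw [Matrix.smul_one_eq_diagonal, Matrix.diagonal_add]
    rw [hd, Matrix.mul_add, Matrix.add_mul, Matrix.mul_smul, Matrix.smul_mul, Matrix.mul_one, hUU]
    congr 1
  rw [he, Matrix.IsUnit.posDef_star_right_conjugate_iff (IsUnit.of_mul_eq_one _ hUU)]
  exact Matrix.PosDef.diagonal hpos

/-- Every symmetric matrix becomes positive definite after adding a large multiple of `I`, so
countably many translates of the cone cover the space; were the cone null, the whole space would be
null. -/
lemma symmVolume_posDef_ne_zero (m : ℕ) :
    symmVolume m {A : Matrix (Fin m) (Fin m) ℝ | A.PosDef} ≠ 0 := by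
  rw [symmVolume, measurableEmbedding_symmOfUpper.map_apply]
  intro h0
  have hu : (Set.univ : Set (UpperCoord m)) ⊆
      ⋃ n : ℕ, (· + upperPart m ((n : ℝ) • 1)) ⁻¹' (symmOfUpper m ⁻¹' {A | A.PosDef}) := by
    intro x _
    obtain ⟨n, hn⟩ := exists_posDef_add_natCast (symmOfUpper_transpose x)
    refine Set.mem_iUnion.2 ⟨n, ?_⟩
    have : symmOfUpper m (x + upperPart m ((n : ℝ) • 1)) = symmOfUpper m x + (n : ℝ) • 1 := by
      conv_rhs => rw [← symmOfUpper_upperPart (A := (n : ℝ) • 1) (by simp)]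
      exact (symmOfUpperLin m).map_add _ _
    rw [Set.mem_preimage, Set.mem_preimage, this]
    exact hn
  have hz := measure_mono_null (μ := (volume : Measure (UpperCoord m))) hu
    (measure_iUnion_null fun n => by rwa [measure_preimage_add_right])
  exact isOpen_univ.measure_ne_zero volume Set.univ_nonempty hz

lemma gammaLIntegral_ne_zero (m : ℕ) (a : ℝ) : gammaLIntegral m a ≠ 0 := by
  refine (setLIntegral_pos_iff (measurable_gammaKernel a).ennreal_ofReal).2 ?_ |>.ne'
  refine (pos_iff_ne_zero.2 (symmVolume_posDef_ne_zero m)).trans_le (measure_mono fun A hA => ?_)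
  exact ⟨by simpa using gammaKernel_pos hA a, hA⟩

lemma multivariateGamma_pos {a : ℝ} (ha : ((m : ℝ) - 1) / 2 < a) :
    0 < multivariateGamma m a := by
  rw [multivariateGamma_eq_toReal]
  exact ENNReal.toReal_pos (gammaLIntegral_ne_zero m a) (gammaLIntegral_lt_top ha).ne

/-- Convergence is essential here: `toReal` sends `∞` to `0`. -/
lemma ofReal_multivariateGamma {a : ℝ} (ha : ((m : ℝ) - 1) / 2 < a) :
    ENNReal.ofReal (multivariateGamma m a) = gammaLIntegral m a := by
  rw [multivariateGamma_eq_toReal, ENNReal.ofReal_toReal (gammaLIntegral_lt_top ha).ne]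

/-! ### Measurability of roots, inverses and beta ratios. -/

instance instSecondCountableTopologyMatrix (m : ℕ) :
    SecondCountableTopology (Matrix (Fin m) (Fin m) ℝ) :=
  inferInstanceAs (SecondCountableTopology (Fin m → Fin m → ℝ))

section RootMeasurable

open scoped MatrixOrder Matrix.Norms.L2Operator

lemma continuousOn_symmRoot :
    ContinuousOn (symmRoot (m := m)) {A | A.PosSemidef} := by
  have := CFC.continuousOn_sqrt (A := Matrix (Fin m) (Fin m) ℝ)
  simp only [Matrix.nonneg_iff_posSemidef] at this
  exact this

lemma symmRoot_of_not_posSemidef {A : Matrix (Fin m) (Fin m) ℝ} (hA : ¬A.PosSemidef) :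
    symmRoot A = 0 :=
  cfcₙ_apply_of_not_predicate A (by rwa [Matrix.nonneg_iff_posSemidef])

end RootMeasurable

/-- The root is continuous on the closed semidefinite cone, and its default value elsewhere is `0`.
-/
lemma measurable_symmRoot : Measurable (symmRoot (m := m)) := by
  classical
  have h : symmRoot (m := m) = Set.piecewise {A | A.PosSemidef} symmRoot 0 := by
    funext A
    by_cases hA : A.PosSemidef
    · exact (Set.piecewise_eq_of_mem _ _ _ (by exact hA)).symm
    · rw [Set.piecewise_eq_of_notMem _ _ _ (by exact hA), symmRoot_of_not_posSemidef hA,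
        Pi.zero_apply]
  rw [h]
  exact continuousOn_symmRoot.measurable_piecewise continuousOn_const
    isClosed_posSemidef.measurableSet

/-- The formula `det⁻¹ • adjugate` also holds at singular matrices, where both sides are `0`, so no
case split is needed. -/
lemma measurable_matrix_inv :
    Measurable fun A : Matrix (Fin m) (Fin m) ℝ => A⁻¹ := by
  have h : (fun A : Matrix (Fin m) (Fin m) ℝ => A⁻¹)
      = (fun p : ℝ × Matrix (Fin m) (Fin m) ℝ => p.1 • p.2) ∘
        fun A => ((A.det)⁻¹, A.adjugate) := by
    funext A
    rw [Matrix.inv_def, Ring.inverse_eq_inv']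
    rfl
  rw [h]
  exact continuous_smul.measurable.comp
    (measurable_matrix_det.inv.prodMk (continuous_id.matrix_adjugate).measurable)

lemma _root_.Measurable.matrix_mul' {α : Type*} [MeasurableSpace α]
    {f g : α → Matrix (Fin m) (Fin m) ℝ} (hf : Measurable f) (hg : Measurable g) :
    Measurable fun x => f x * g x :=
  (continuous_fst.mul continuous_snd :
    Continuous fun p : Matrix (Fin m) (Fin m) ℝ × Matrix (Fin m) (Fin m) ℝ =>
      p.1 * p.2).measurable.comp (hf.prodMk hg)

lemma _root_.Measurable.matrix_add' {α : Type*} [MeasurableSpace α]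
    {f g : α → Matrix (Fin m) (Fin m) ℝ} (hf : Measurable f) (hg : Measurable g) :
    Measurable fun x => f x + g x :=
  (continuous_fst.add continuous_snd :
    Continuous fun p : Matrix (Fin m) (Fin m) ℝ × Matrix (Fin m) (Fin m) ℝ =>
      p.1 + p.2).measurable.comp (hf.prodMk hg)

lemma measurable_ratioI {α : Type*} [MeasurableSpace α]
    {f g : α → Matrix (Fin m) (Fin m) ℝ} (hf : Measurable f) (hg : Measurable g) :
    Measurable fun x => ratioI (f x) (g x) := by
  have hr := measurable_symmRoot.comp hg
  have hri := measurable_matrix_inv.comp hr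
  have h2 : Measurable fun x => ratioII (f x) (g x) := (hri.matrix_mul' hf).matrix_mul' hri
  have hs : Measurable fun x => sumRoot (f x) (g x) :=
    hr.matrix_mul' (measurable_symmRoot.comp (measurable_const.matrix_add' h2))
  have hsi := measurable_matrix_inv.comp hs
  have ht : Measurable fun A : Matrix (Fin m) (Fin m) ℝ => Aᵀ :=
    (continuous_id.matrix_transpose).measurable
  exact (hsi.matrix_mul' hf).matrix_mul' (ht.comp hsi)

/-! ### The substitution from `(A, B)` to `(V₁, V₂)` at fixed `C`. -/

lemma isUnit_det_of_posDef {A : Matrix (Fin m) (Fin m) ℝ} (hA : A.PosDef) : IsUnit A.det :=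
  isUnit_iff_ne_zero.2 hA.det_pos.ne'

lemma det_symmRoot_mul_self {C : Matrix (Fin m) (Fin m) ℝ} (hC : C.PosDef) :
    (symmRoot C).det * (symmRoot C).det = C.det := by
  rw [← Matrix.det_mul, symmRoot_mul_self hC.posSemidef]

lemma abs_det_symmRoot_pow {C : Matrix (Fin m) (Fin m) ℝ} (hC : C.PosDef) :
    |(symmRoot C).det| ^ (m + 1) = C.det ^ (((m : ℝ) + 1) / 2) := by
  rw [← det_symmRoot_mul_self hC, ← abs_mul_abs_self, ← sq, ← Real.rpow_natCast _ 2,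
    ← Real.rpow_mul (abs_nonneg _), ← Real.rpow_natCast]
  congr 1
  push_cast
  ring

lemma det_conj_symmRoot {C : Matrix (Fin m) (Fin m) ℝ} (hC : C.PosDef)
    (X : Matrix (Fin m) (Fin m) ℝ) :
    (symmRoot C * X * symmRoot C).det = C.det * X.det := by
  rw [Matrix.det_mul, Matrix.det_mul, ← det_symmRoot_mul_self hC]
  ring

lemma trace_conj_symmRoot {C : Matrix (Fin m) (Fin m) ℝ} (hC : C.PosDef)
    (X : Matrix (Fin m) (Fin m) ℝ) :
    (symmRoot C * X * symmRoot C).trace = (C * X).trace := by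
  rw [Matrix.trace_mul_comm, ← Matrix.mul_assoc, symmRoot_mul_self hC.posSemidef]

/-- The inverse of the beta type I matrix is `I + C^{1/2} A⁻¹ C^{1/2}`. -/
lemma inv_ratioI {A C : Matrix (Fin m) (Fin m) ℝ} (hA : A.PosDef) (hC : C.PosDef) :
    (ratioI A C)⁻¹ = symmRoot C * A⁻¹ * symmRoot C + 1 := by
  have hu := isUnit_det_symmRoot hC
  have hFinv : (ratioII A C)⁻¹ = symmRoot C * A⁻¹ * symmRoot C := by
    rw [ratioII, Matrix.mul_inv_rev, Matrix.mul_inv_rev, Matrix.nonsing_inv_nonsing_inv _ hu,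
      Matrix.mul_assoc]
  have hFu : IsUnit (ratioII A C).det := by
    rw [ratioII, Matrix.det_mul, Matrix.det_mul]
    exact ((Matrix.isUnit_nonsing_inv_det _ hu).mul (isUnit_det_of_posDef hA)).mul
      (Matrix.isUnit_nonsing_inv_det _ hu)
  have hG := isUnit_det_of_posDef (posDef_one_add_ratioII (C := C) hA.posSemidef)
  have h1 : (1 - ratioI A C)⁻¹ = 1 + ratioII A C := by
    rw [← inv_one_sub_ratioI hA.posSemidef]; abel
  have hu1 : IsUnit (1 - ratioI A C).det := by
    rw [← Matrix.isUnit_nonsing_inv_det_iff, h1]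
    exact hG
  have h2 : 1 - ratioI A C = (1 + ratioII A C)⁻¹ := by
    rw [← h1, Matrix.nonsing_inv_nonsing_inv _ hu1]
  have h3 : ratioI A C = 1 - (1 + ratioII A C)⁻¹ := by rw [← h2]; abel
  rw [← hFinv]
  refine Matrix.inv_eq_right_inv ?_
  -- With `F = ratioII A C` and `U = I - (I + F)⁻¹`, this identity gives `U (F⁻¹ + I) = (F⁻¹ + I) -
  -- F⁻¹ = I`.
  have h4 : (1 + ratioII A C) * (ratioII A C)⁻¹ = (ratioII A C)⁻¹ + 1 := by
    rw [Matrix.add_mul, Matrix.one_mul, Matrix.mul_nonsing_inv _ hFu]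
  rw [h3, ← h4, Matrix.sub_mul, Matrix.nonsing_inv_mul_cancel_left _ _ hG, h4, Matrix.one_mul]
  abel

/-- The gamma integral with scale matrix `M⁻¹`. -/
lemma setLIntegral_exp_trace_mul_det_rpow {M : Matrix (Fin m) (Fin m) ℝ} (hM : M.PosDef) (s : ℝ) :
    ∫⁻ C in {C : Matrix (Fin m) (Fin m) ℝ | C.PosDef},
        ENNReal.ofReal (Real.exp (-(M * C).trace) * C.det ^ (s - ((m : ℝ) + 1) / 2)) ∂symmVolume m
      = ENNReal.ofReal (M.det ^ (-s)) * gammaLIntegral m s := by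
  -- The standard gamma integral on the right is substituted by `C ↦ M^{1/2} C M^{1/2}`; all powers
  -- of `|M|` then cancel.
  rw [gammaLIntegral, setLIntegral_posDef_conj (symmRoot_transpose M) (isUnit_det_symmRoot hM)
      fun C => ENNReal.ofReal (gammaKernel m s C),
    abs_det_symmRoot_pow hM, ← mul_assoc, ← lintegral_const_mul' _ _ (by finiteness)]
  refine setLIntegral_congr_fun measurableSet_posDef fun C hC => ?_
  have hC : C.PosDef := hC
  have hd := hM.det_pos
  simp only [gammaKernel, det_conj_symmRoot hM, trace_conj_symmRoot hM, Matrix.trace_neg]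
  rw [← ENNReal.ofReal_mul (by positivity), ← ENNReal.ofReal_mul (by positivity),
    Real.mul_rpow hd.le hC.det_pos.le]
  congr 1
  have : M.det ^ (-s) * M.det ^ (((m : ℝ) + 1) / 2) * M.det ^ (s - ((m : ℝ) + 1) / 2) = 1 := by
    rw [← Real.rpow_add hd, ← Real.rpow_add hd]
    simp
  linear_combination (-(Real.exp (-(M * C).trace) * C.det ^ (s - ((m : ℝ) + 1) / 2))) * this

/-- The substitution `A = C^{1/2} (V - I)⁻¹ C^{1/2}` on positive definite matrices. -/
lemma setLIntegral_posDef_symmRoot_inv {C : Matrix (Fin m) (Fin m) ℝ} (hC : C.PosDef)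
    (f : Matrix (Fin m) (Fin m) ℝ → ℝ≥0∞) :
    ∫⁻ A in {A | A.PosDef}, f A ∂symmVolume m
      = ∫⁻ V in {V | (V - 1).PosDef}, ENNReal.ofReal
          (C.det ^ (((m : ℝ) + 1) / 2) * (V - 1).det⁻¹ ^ (m + 1))
          * f (symmRoot C * (V - 1)⁻¹ * symmRoot C) ∂symmVolume m := by
  -- Congruence by `C^{1/2}`, inversion, then the shift by `I`, with Jacobians `|C|^{(m+1)/2}`,
  -- `|X|^{-(m+1)}` and `1`.
  rw [setLIntegral_posDef_conj (symmRoot_transpose C) (isUnit_det_symmRoot hC),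
    setLIntegral_posDef_inv, ← setLIntegral_preimage_add_right (B := -1) (by simp) _
      measurableSet_posDef, abs_det_symmRoot_pow hC, ← lintegral_const_mul' _ _ (by finiteness)]
  simp only [← sub_eq_add_neg]
  refine setLIntegral_congr_fun ?_ fun V _ => ?_
  · exact (continuous_id.sub continuous_const).measurable measurableSet_posDef
  · have := hC.det_pos
    rw [← mul_assoc, ← ENNReal.ofReal_mul (by positivity)]

lemma matrixGamma_one_eq (a : ℝ) :
    matrixGamma m a 1 = ((symmVolume m).restrict {A | A.PosDef}).withDensity
      fun A => ENNReal.ofReal (gammaKernel m a A / multivariateGamma m a) := by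
  rw [← withDensity_indicator measurableSet_posDef, matrixGamma]
  congr 1
  funext A
  by_cases hA : A ∈ {A : Matrix (Fin m) (Fin m) ℝ | A.PosDef}
  · rw [Set.indicator_of_mem hA, matrixGammaDensity, Set.indicator_of_mem hA]
    simp only [Matrix.det_one, Real.one_rpow, mul_one, inv_one, Matrix.one_mul, gammaKernel,
      Matrix.trace_neg]
    congr 1
    ring
  · rw [Set.indicator_of_notMem hA, matrixGammaDensity, Set.indicator_of_notMem hA,
      ENNReal.ofReal_zero]

/-! ### The joint density of `(V₁, V₂, C)` and its integral over `C`. -/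

/-- The joint kernel of `(V₁, V₂, C)`. -/
def jointKernel (m : ℕ) (a b c : ℝ) (W₁ W₂ C : Matrix (Fin m) (Fin m) ℝ) : ℝ :=
  W₁.det ^ (-a - ((m : ℝ) + 1) / 2) * W₂.det ^ (-b - ((m : ℝ) + 1) / 2)
      / (multivariateGamma m a * multivariateGamma m b * multivariateGamma m c)
    * (Real.exp (-((1 + W₁⁻¹ + W₂⁻¹) * C).trace) * C.det ^ (a + b + c - ((m : ℝ) + 1) / 2))

/-- The Jacobian restores the missing `(m + 1) / 2` in the exponent of `|C|`, and for `|W|` the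
exponents add up as `-(m + 1) - (a - (m + 1) / 2) = -a - (m + 1) / 2`. -/
lemma gammaKernel_conj_inv {W C : Matrix (Fin m) (Fin m) ℝ} (hW : W.PosDef) (hC : C.PosDef)
    (a : ℝ) :
    C.det ^ (((m : ℝ) + 1) / 2) * W.det⁻¹ ^ (m + 1)
        * gammaKernel m a (symmRoot C * W⁻¹ * symmRoot C)
      = Real.exp (-(W⁻¹ * C).trace) * C.det ^ a * W.det ^ (-a - ((m : ℝ) + 1) / 2) := by
  have hw := hW.det_pos
  have hc := hC.det_pos
  rw [gammaKernel, Matrix.trace_neg, trace_conj_symmRoot hC, det_conj_symmRoot hC,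
    Matrix.det_nonsing_inv, Ring.inverse_eq_inv', Real.mul_rpow hc.le (by positivity),
    Real.inv_rpow hw.le, ← Real.rpow_neg hw.le, ← Real.rpow_neg_one W.det, ← Real.rpow_natCast,
    ← Real.rpow_mul hw.le, Matrix.trace_mul_comm C]
  have h1 : C.det ^ a = C.det ^ (((m : ℝ) + 1) / 2) * C.det ^ (a - ((m : ℝ) + 1) / 2) := by
    rw [← Real.rpow_add hc]
    ring_nf
  have h2 : W.det ^ (-a - ((m : ℝ) + 1) / 2)
      = W.det ^ (-1 * ((m + 1 : ℕ) : ℝ)) * W.det ^ (-(a - ((m : ℝ) + 1) / 2)) := by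
    rw [← Real.rpow_add hw]
    push_cast
    ring_nf
  rw [h1, h2]
  ring

lemma jointKernel_eq {a b c : ℝ} {W₁ W₂ C : Matrix (Fin m) (Fin m) ℝ} (h1 : W₁.PosDef)
    (h2 : W₂.PosDef) (hC : C.PosDef) :
    gammaKernel m c C / multivariateGamma m c
        * (C.det ^ (((m : ℝ) + 1) / 2) * W₁.det⁻¹ ^ (m + 1)
          * (gammaKernel m a (symmRoot C * W₁⁻¹ * symmRoot C) / multivariateGamma m a))
        * (C.det ^ (((m : ℝ) + 1) / 2) * W₂.det⁻¹ ^ (m + 1)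
          * (gammaKernel m b (symmRoot C * W₂⁻¹ * symmRoot C) / multivariateGamma m b))
      = jointKernel m a b c W₁ W₂ C := by
  rw [← mul_div_assoc (_ * _ : ℝ) (gammaKernel m a _), ← mul_div_assoc (_ * _ : ℝ) (gammaKernel m b _),
    gammaKernel_conj_inv h1 hC, gammaKernel_conj_inv h2 hC, jointKernel, gammaKernel]
  have hc := hC.det_pos
  have e1 : Real.exp (-((1 + W₁⁻¹ + W₂⁻¹) * C).trace)
      = Real.exp (-C).trace * Real.exp (-(W₁⁻¹ * C).trace) * Real.exp (-(W₂⁻¹ * C).trace) := by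
    rw [← Real.exp_add, ← Real.exp_add, Matrix.add_mul, Matrix.add_mul, Matrix.trace_add,
      Matrix.trace_add, Matrix.trace_neg, Matrix.one_mul]
    ring_nf
  have e2 : C.det ^ (a + b + c - ((m : ℝ) + 1) / 2)
      = C.det ^ a * C.det ^ b * C.det ^ (c - ((m : ℝ) + 1) / 2) := by
    rw [← Real.rpow_add hc, ← Real.rpow_add hc]
    ring_nf
  rw [e1, e2]
  field_simp

/-- Here `v_i`, `w_i`, `d` stand for `|V_i|`, `|V_i - I|`, `|M|`. The powers of `v₁` and `v₂`
cancel; after taking logarithms the identity is linear in the logarithms. -/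
lemma rpow_mul_rpow_div_eq {v₁ v₂ w₁ w₂ d : ℝ} (hv₁ : 0 < v₁) (hv₂ : 0 < v₂) (hw₁ : 0 < w₁)
    (hw₂ : 0 < w₂) (hd : 0 < d) (β a b c p : ℝ) :
    v₁ ^ (-a - p) * v₂ ^ (-b - p) * (w₁ / v₁) ^ (b + c - p) * (w₂ / v₂) ^ (a + c - p)
        / (β * (w₁ * d * w₂ / (v₁ * v₂)) ^ (a + b + c))
      = w₁ ^ (-a - p) * w₂ ^ (-b - p) * d ^ (-(a + b + c)) / β := by
  rw [mul_comm β, ← div_div]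
  congr 1
  rw [← Real.exp_log hv₁, ← Real.exp_log hv₂, ← Real.exp_log hw₁, ← Real.exp_log hw₂,
    ← Real.exp_log hd]
  simp only [← Real.exp_add, ← Real.exp_sub, ← Real.exp_mul]
  congr 1
  ring

lemma bgbIInvDensity_eq {a b c : ℝ} {V₁ V₂ : Matrix (Fin m) (Fin m) ℝ} (h1 : (V₁ - 1).PosDef)
    (h2 : (V₂ - 1).PosDef) :
    bgbIInvDensity m a b c (V₁, V₂)
      = (V₁ - 1).det ^ (-a - ((m : ℝ) + 1) / 2) * (V₂ - 1).det ^ (-b - ((m : ℝ) + 1) / 2)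
        * (1 + (V₁ - 1)⁻¹ + (V₂ - 1)⁻¹).det ^ (-(a + b + c)) / betaStar m a b c := by
  have hV1 : V₁.PosDef := by simpa using h1.add Matrix.PosDef.one
  have hV2 : V₂.PosDef := by simpa using h2.add Matrix.PosDef.one
  have hM : (1 + (V₁ - 1)⁻¹ + (V₂ - 1)⁻¹).PosDef := (Matrix.PosDef.one.add h1.inv).add h2.inv
  have d1 : (1 - V₁⁻¹).det = (V₁ - 1).det / V₁.det := by
    rw [eq_div_iff hV1.det_pos.ne', ← Matrix.det_mul, Matrix.sub_mul, Matrix.one_mul,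
      Matrix.nonsing_inv_mul _ (isUnit_det_of_posDef hV1)]
  have d2 : (1 - V₂⁻¹).det = (V₂ - 1).det / V₂.det := by
    rw [eq_div_iff hV2.det_pos.ne', ← Matrix.det_mul, Matrix.sub_mul, Matrix.one_mul,
      Matrix.nonsing_inv_mul _ (isUnit_det_of_posDef hV2)]
  have hu : IsUnit (V₁ * V₂).det := by
    rw [Matrix.det_mul]
    exact (isUnit_det_of_posDef hV1).mul (isUnit_det_of_posDef hV2)
  -- With `W_i = V_i - I`, both sides equal `W₁ W₂ + W₁ + W₂`. The product `V₁ V₂` need not be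
  -- symmetric, but only determinants are used.
  have hprod : V₁ * V₂ - 1
      = (V₁ - 1) * (1 + (V₁ - 1)⁻¹ + (V₂ - 1)⁻¹) * (V₂ - 1) := by
    have e1 := Matrix.mul_nonsing_inv _ (isUnit_det_of_posDef h1)
    have e2 := Matrix.nonsing_inv_mul _ (isUnit_det_of_posDef h2)
    calc V₁ * V₂ - 1 = (V₁ - 1) * (V₂ - 1) + (V₂ - 1) + (V₁ - 1) := by noncomm_ring
      _ = (V₁ - 1) * (V₂ - 1) + ((V₁ - 1) * (V₁ - 1)⁻¹) * (V₂ - 1)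
          + (V₁ - 1) * ((V₂ - 1)⁻¹ * (V₂ - 1)) := by
        rw [e1, e2, Matrix.one_mul, Matrix.mul_one]
      _ = _ := by
        simp only [Matrix.mul_add, Matrix.add_mul, Matrix.mul_one, Matrix.mul_assoc]
  have d3 : (1 - (V₁ * V₂)⁻¹).det = (V₁ - 1).det * (1 + (V₁ - 1)⁻¹ + (V₂ - 1)⁻¹).det
      * (V₂ - 1).det / (V₁.det * V₂.det) := by
    rw [eq_div_iff (mul_pos hV1.det_pos hV2.det_pos).ne', ← Matrix.det_mul, ← Matrix.det_mul,
      ← Matrix.det_mul, ← Matrix.det_mul, ← hprod, Matrix.sub_mul, Matrix.one_mul,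
      Matrix.nonsing_inv_mul _ hu]
  have hmem : (V₁, V₂) ∈ {V : Matrix (Fin m) (Fin m) ℝ × Matrix (Fin m) (Fin m) ℝ |
      (V.1 - 1).PosDef ∧ (V.2 - 1).PosDef} := ⟨h1, h2⟩
  rw [bgbIInvDensity, Set.indicator_of_mem hmem]
  simp only
  rw [d1, d2, d3]
  exact rpow_mul_rpow_div_eq hV1.det_pos hV2.det_pos h1.det_pos h2.det_pos hM.det_pos _ _ _ _ _

/-- In `C` the kernel is an unnormalised gamma density of parameter `a + b + c` and scale `M⁻¹`; its
mass supplies the factor `Γ_m[a + b + c]` of `1 / β*`. -/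
lemma setLIntegral_jointKernel {a b c : ℝ} (ha : ((m : ℝ) - 1) / 2 < a)
    (hb : ((m : ℝ) - 1) / 2 < b) (hc : ((m : ℝ) - 1) / 2 < c)
    (hs : ((m : ℝ) - 1) / 2 < a + b + c) {V₁ V₂ : Matrix (Fin m) (Fin m) ℝ}
    (h1 : (V₁ - 1).PosDef) (h2 : (V₂ - 1).PosDef) :
    ∫⁻ C in {C | C.PosDef}, ENNReal.ofReal (jointKernel m a b c (V₁ - 1) (V₂ - 1) C) ∂symmVolume m
      = ENNReal.ofReal (bgbIInvDensity m a b c (V₁, V₂)) := by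
  have hga := multivariateGamma_pos ha
  have hgb := multivariateGamma_pos hb
  have hgc := multivariateGamma_pos hc
  have hgs := multivariateGamma_pos hs
  have hd1 := h1.det_pos
  have hd2 := h2.det_pos
  have hM : (1 + (V₁ - 1)⁻¹ + (V₂ - 1)⁻¹).PosDef := (Matrix.PosDef.one.add h1.inv).add h2.inv
  have hd3 := hM.det_pos
  simp only [jointKernel]
  simp_rw [fun C : Matrix (Fin m) (Fin m) ℝ => ENNReal.ofReal_mul
    (p := (V₁ - 1).det ^ (-a - ((m : ℝ) + 1) / 2) * (V₂ - 1).det ^ (-b - ((m : ℝ) + 1) / 2)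
      / (multivariateGamma m a * multivariateGamma m b * multivariateGamma m c))
    (q := Real.exp (-((1 + (V₁ - 1)⁻¹ + (V₂ - 1)⁻¹) * C).trace)
      * C.det ^ (a + b + c - ((m : ℝ) + 1) / 2)) (by positivity)]
  rw [lintegral_const_mul' _ _ ENNReal.ofReal_ne_top, setLIntegral_exp_trace_mul_det_rpow hM,
    ← ofReal_multivariateGamma hs, ← ENNReal.ofReal_mul (by positivity),
    ← ENNReal.ofReal_mul (by positivity), bgbIInvDensity_eq h1 h2, betaStar]
  congr 1
  field_simp

/-! ### Measurability of the densities and assembly by Tonelli. -/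

lemma measurable_bgbIInvDensity (a b c : ℝ) : Measurable (bgbIInvDensity m a b c) := by
  have hs : MeasurableSet {V : Matrix (Fin m) (Fin m) ℝ × Matrix (Fin m) (Fin m) ℝ |
      (V.1 - 1).PosDef ∧ (V.2 - 1).PosDef} :=
    ((continuous_fst.sub continuous_const).measurable measurableSet_posDef).inter
      ((continuous_snd.sub continuous_const).measurable measurableSet_posDef)
  have hi (f : Matrix (Fin m) (Fin m) ℝ × Matrix (Fin m) (Fin m) ℝ → Matrix (Fin m) (Fin m) ℝ)
      (hf : Measurable f) : Measurable fun V => (1 - (f V)⁻¹).det :=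
    measurable_matrix_det.comp
      ((continuous_const.sub continuous_id).measurable.comp (measurable_matrix_inv.comp hf))
  have hV : Measurable fun V : Matrix (Fin m) (Fin m) ℝ × Matrix (Fin m) (Fin m) ℝ => V.1 :=
    measurable_fst
  have hV' : Measurable fun V : Matrix (Fin m) (Fin m) ℝ × Matrix (Fin m) (Fin m) ℝ => V.2 :=
    measurable_snd
  refine Measurable.indicator ?_ hs
  exact (((((measurable_matrix_det.comp hV).pow_const _).mul
    ((measurable_matrix_det.comp hV').pow_const _)).mul ((hi _ hV).pow_const _)).mul
    ((hi _ hV').pow_const _)).div (((hi _ (hV.matrix_mul' hV')).pow_const _).const_mul _)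

lemma measurable_jointKernel (a b c : ℝ) {α : Type*} [MeasurableSpace α]
    {f g h : α → Matrix (Fin m) (Fin m) ℝ} (hf : Measurable f) (hg : Measurable g)
    (hh : Measurable h) : Measurable fun x => jointKernel m a b c (f x) (g x) (h x) := by
  have hM : Measurable fun x => (1 + (f x)⁻¹ + (g x)⁻¹) * h x :=
    ((measurable_const.matrix_add' (measurable_matrix_inv.comp hf)).matrix_add'
      (measurable_matrix_inv.comp hg)).matrix_mul' hh
  exact ((((measurable_matrix_det.comp hf).pow_const _).mul
    ((measurable_matrix_det.comp hg).pow_const _)).div_const _).mul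
    ((measurable_matrix_trace.comp hM).neg.exp.mul ((measurable_matrix_det.comp hh).pow_const _))

lemma measurable_sub_one :
    Measurable fun V : Matrix (Fin m) (Fin m) ℝ => V - 1 :=
  (continuous_id.sub continuous_const).measurable

lemma measurableSet_sub_one_posDef :
    MeasurableSet {V : Matrix (Fin m) (Fin m) ℝ | (V - 1).PosDef} :=
  measurable_sub_one measurableSet_posDef

/-- The substitution `(A, B) ↦ (V₁, V₂)` for fixed `C`. -/
lemma lintegral_ratioI_inv_of_posDef {a b c : ℝ} (ha : ((m : ℝ) - 1) / 2 < a)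
    (hb : ((m : ℝ) - 1) / 2 < b) (hc : ((m : ℝ) - 1) / 2 < c)
    {C : Matrix (Fin m) (Fin m) ℝ} (hC : C.PosDef)
    (f : Matrix (Fin m) (Fin m) ℝ × Matrix (Fin m) (Fin m) ℝ → ℝ≥0∞) :
    ∫⁻ B in {B | B.PosDef}, ∫⁻ A in {A | A.PosDef},
        ENNReal.ofReal (gammaKernel m a A / multivariateGamma m a)
          * (ENNReal.ofReal (gammaKernel m b B / multivariateGamma m b)
            * ENNReal.ofReal (gammaKernel m c C / multivariateGamma m c))
          * f ((ratioI A C)⁻¹, (ratioI B C)⁻¹) ∂symmVolume m ∂symmVolume m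
      = ∫⁻ V₂ in {V | (V - 1).PosDef}, ∫⁻ V₁ in {V | (V - 1).PosDef},
        ENNReal.ofReal (jointKernel m a b c (V₁ - 1) (V₂ - 1) C) * f (V₁, V₂)
          ∂symmVolume m ∂symmVolume m := by
  have hga := multivariateGamma_pos ha
  have hgb := multivariateGamma_pos hb
  have hgc := multivariateGamma_pos hc
  have hu := isUnit_det_symmRoot hC
  -- The substituted matrix is sent back to `V`, so the test function ends up evaluated at `(V₁,
  -- V₂)`.
  have hback {V : Matrix (Fin m) (Fin m) ℝ} (hV : (V - 1).PosDef) :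
      (ratioI (symmRoot C * (V - 1)⁻¹ * symmRoot C) C)⁻¹ = V := by
    rw [inv_ratioI ((posDef_conj (symmRoot_transpose C) hu).2 hV.inv) hC, Matrix.mul_inv_rev,
      Matrix.mul_inv_rev, Matrix.nonsing_inv_nonsing_inv _ (isUnit_det_of_posDef hV),
      Matrix.mul_nonsing_inv_cancel_left _ _ hu, Matrix.nonsing_inv_mul_cancel_right _ _ hu,
      sub_add_cancel]
  rw [setLIntegral_posDef_symmRoot_inv hC]
  refine setLIntegral_congr_fun measurableSet_sub_one_posDef fun V₂ h2 => ?_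
  have h2 : (V₂ - 1).PosDef := h2
  rw [setLIntegral_posDef_symmRoot_inv hC, ← lintegral_const_mul' _ _ ENNReal.ofReal_ne_top]
  refine setLIntegral_congr_fun measurableSet_sub_one_posDef fun V₁ h1 => ?_
  have h1 : (V₁ - 1).PosDef := h1
  rw [hback h1, hback h2, ← jointKernel_eq h1 h2 hC]
  have hd := hC.det_pos
  have hd1 := h1.det_pos
  have hd2 := h2.det_pos
  have k1 := (gammaKernel_pos ((posDef_conj (symmRoot_transpose C) hu).2 h1.inv) a).le
  have k3 := (gammaKernel_pos hC c).le
  have e {x y z u v : ℝ} (hx : 0 ≤ x) (hy : 0 ≤ y) (hz : 0 ≤ z) (hu : 0 ≤ u) :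
      ENNReal.ofReal (x * (y * z) * (u * v)) = ENNReal.ofReal x
        * (ENNReal.ofReal y * ENNReal.ofReal z) * (ENNReal.ofReal u * ENNReal.ofReal v) := by
    rw [ENNReal.ofReal_mul (by positivity), ENNReal.ofReal_mul hx, ENNReal.ofReal_mul hy,
      ENNReal.ofReal_mul hu]
  rw [e (by positivity) (by positivity) (by positivity) (by positivity)]
  ring

/-- The law of the pair of inverses of a bimatrix variate generalised beta type I pair. -/
lemma map_inv_bgbI {a b c : ℝ} (ha : ((m : ℝ) - 1) / 2 < a)
    (hb : ((m : ℝ) - 1) / 2 < b) (hc : ((m : ℝ) - 1) / 2 < c)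
    (hs : ((m : ℝ) - 1) / 2 < a + b + c) :
    Measure.map (fun U => (U.1⁻¹, U.2⁻¹)) (bgbI m a b c)
      = ((symmVolume m).prod (symmVolume m)).withDensity
        fun V => ENNReal.ofReal (bgbIInvDensity m a b c V) := by
  have hinv : Measurable fun U : Matrix (Fin m) (Fin m) ℝ × Matrix (Fin m) (Fin m) ℝ =>
      (U.1⁻¹, U.2⁻¹) :=
    (measurable_matrix_inv.comp measurable_fst).prodMk (measurable_matrix_inv.comp measurable_snd)
  have hratio : Measurable fun T : Matrix (Fin m) (Fin m) ℝ ×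
      Matrix (Fin m) (Fin m) ℝ × Matrix (Fin m) (Fin m) ℝ =>
      (ratioI T.1 T.2.2, ratioI T.2.1 T.2.2) :=
    (measurable_ratioI measurable_fst measurable_snd.snd).prodMk
      (measurable_ratioI measurable_snd.fst measurable_snd.snd)
  have hk (a : ℝ) : Measurable fun A : Matrix (Fin m) (Fin m) ℝ =>
      ENNReal.ofReal (gammaKernel m a A / multivariateGamma m a) :=
    ((measurable_gammaKernel a).div_const _).ennreal_ofReal
  have hkbc : Measurable fun q : Matrix (Fin m) (Fin m) ℝ × Matrix (Fin m) (Fin m) ℝ =>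
      ENNReal.ofReal (gammaKernel m b q.1 / multivariateGamma m b)
        * ENNReal.ofReal (gammaKernel m c q.2 / multivariateGamma m c) :=
    ((hk b).comp measurable_fst).mul ((hk c).comp measurable_snd)
  have hkabc : Measurable fun T : Matrix (Fin m) (Fin m) ℝ ×
      Matrix (Fin m) (Fin m) ℝ × Matrix (Fin m) (Fin m) ℝ =>
      ENNReal.ofReal (gammaKernel m a T.1 / multivariateGamma m a)
        * (ENNReal.ofReal (gammaKernel m b T.2.1 / multivariateGamma m b)
          * ENNReal.ofReal (gammaKernel m c T.2.2 / multivariateGamma m c)) :=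
    ((hk a).comp measurable_fst).mul (hkbc.comp measurable_snd)
  rw [bgbI, Measure.map_map hinv hratio]
  -- The two measures are compared through integrals of nonnegative test functions.
  refine Measure.ext_of_lintegral _ fun f hf => ?_
  have hG : Measurable fun T : Matrix (Fin m) (Fin m) ℝ ×
      Matrix (Fin m) (Fin m) ℝ × Matrix (Fin m) (Fin m) ℝ =>
      ENNReal.ofReal (gammaKernel m a T.1 / multivariateGamma m a)
          * (ENNReal.ofReal (gammaKernel m b T.2.1 / multivariateGamma m b)
            * ENNReal.ofReal (gammaKernel m c T.2.2 / multivariateGamma m c))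
          * f ((ratioI T.1 T.2.2)⁻¹, (ratioI T.2.1 T.2.2)⁻¹) :=
    hkabc.mul (hf.comp (hinv.comp hratio))
  -- The variables are grouped as `((C, V₂), V₁)` to fit the two exchanges of integrals below.
  have hH : Measurable fun T : (Matrix (Fin m) (Fin m) ℝ × Matrix (Fin m) (Fin m) ℝ) ×
      Matrix (Fin m) (Fin m) ℝ =>
      ENNReal.ofReal (jointKernel m a b c (T.2 - 1) (T.1.2 - 1) T.1.1) * f (T.2, T.1.2) :=
    (measurable_jointKernel a b c (measurable_sub_one.comp measurable_snd)
      (measurable_sub_one.comp measurable_fst.snd) measurable_fst.fst).ennreal_ofReal.mul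
      (hf.comp (measurable_snd.prodMk measurable_fst.snd))
  have hD := (measurable_bgbIInvDensity (m := m) a b c).ennreal_ofReal
  rw [lintegral_map hf (hinv.comp hratio), matrixGamma_one_eq, matrixGamma_one_eq,
    matrixGamma_one_eq, prod_withDensity (hk b) (hk c),
    prod_withDensity (hk a) hkbc]
  calc _ = ∫⁻ C in {C | C.PosDef}, ∫⁻ B in {B | B.PosDef}, ∫⁻ A in {A | A.PosDef},
        ENNReal.ofReal (gammaKernel m a A / multivariateGamma m a)
          * (ENNReal.ofReal (gammaKernel m b B / multivariateGamma m b)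
            * ENNReal.ofReal (gammaKernel m c C / multivariateGamma m c))
          * f ((ratioI A C)⁻¹, (ratioI B C)⁻¹) ∂symmVolume m ∂symmVolume m ∂symmVolume m := by
        refine (lintegral_withDensity_eq_lintegral_mul _ hkabc
          (hf.comp (hinv.comp hratio))).trans ?_
        -- The symmetric form of Tonelli makes the last variable the outermost, so `C` is fixed
        -- while `A` and `B` are substituted.
        refine (lintegral_prod_symm _ hG.aemeasurable).trans ?_
        exact lintegral_prod_symm _ hG.lintegral_prod_left'.aemeasurable
    _ = ∫⁻ C in {C | C.PosDef}, ∫⁻ V₂ in {V | (V - 1).PosDef}, ∫⁻ V₁ in {V | (V - 1).PosDef},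
        ENNReal.ofReal (jointKernel m a b c (V₁ - 1) (V₂ - 1) C) * f (V₁, V₂)
          ∂symmVolume m ∂symmVolume m ∂symmVolume m :=
        setLIntegral_congr_fun measurableSet_posDef fun C hC =>
          lintegral_ratioI_inv_of_posDef ha hb hc hC f
    _ = ∫⁻ V₂ in {V | (V - 1).PosDef}, ∫⁻ V₁ in {V | (V - 1).PosDef}, ∫⁻ C in {C | C.PosDef},
        ENNReal.ofReal (jointKernel m a b c (V₁ - 1) (V₂ - 1) C) * f (V₁, V₂)
          ∂symmVolume m ∂symmVolume m ∂symmVolume m := by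
        -- `C` is moved inward past `V₂` and then past `V₁`.
        rw [lintegral_lintegral_swap hH.lintegral_prod_right'.aemeasurable]
        refine lintegral_congr fun V₂ => lintegral_lintegral_swap ?_
        exact (hH.comp ((measurable_fst.prodMk measurable_const).prodMk
          measurable_snd)).aemeasurable
    _ = ∫⁻ V₂ in {V | (V - 1).PosDef}, ∫⁻ V₁ in {V | (V - 1).PosDef},
        ENNReal.ofReal (bgbIInvDensity m a b c (V₁, V₂)) * f (V₁, V₂)
          ∂symmVolume m ∂symmVolume m := by
        refine setLIntegral_congr_fun measurableSet_sub_one_posDef fun V₂ h2 =>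
          setLIntegral_congr_fun measurableSet_sub_one_posDef fun V₁ h1 => ?_
        rw [← setLIntegral_jointKernel ha hb hc hs h1 h2]
        exact lintegral_mul_const _ (measurable_jointKernel a b c measurable_const
          measurable_const measurable_id).ennreal_ofReal
    _ = ∫⁻ V in {V | (V - 1).PosDef} ×ˢ {V | (V - 1).PosDef},
        ENNReal.ofReal (bgbIInvDensity m a b c V) * f V ∂(symmVolume m).prod (symmVolume m) := by
        rw [← Measure.prod_restrict]
        exact (lintegral_prod_symm _ (hD.mul hf).aemeasurable).symm
    _ = _ := by
        rw [lintegral_withDensity_eq_lintegral_mul _ hD hf, ← lintegral_indicator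
          (measurableSet_sub_one_posDef.prod measurableSet_sub_one_posDef)]
        refine lintegral_congr fun V => ?_
        by_cases hV : V ∈ {V : Matrix (Fin m) (Fin m) ℝ | (V - 1).PosDef} ×ˢ
            {V : Matrix (Fin m) (Fin m) ℝ | (V - 1).PosDef}
        · rw [Set.indicator_of_mem hV]
          rfl
        · rw [Set.indicator_of_notMem hV, Pi.mul_apply, bgbIInvDensity,
            Set.indicator_of_notMem (by exact hV), ENNReal.ofReal_zero, zero_mul]

end BimatrixBeta

end

theorem mainTheorem5 (m : ℕ) (hm : 1 ≤ m) (a b c : ℝ)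
    (ha : ((m : ℝ) - 1) / 2 < a) (hb : ((m : ℝ) - 1) / 2 < b) (hc : ((m : ℝ) - 1) / 2 < c)
    {Ω : Type*} [MeasurableSpace Ω] (P : MeasureTheory.Measure Ω)
    [MeasureTheory.IsProbabilityMeasure P]
    (U₁ U₂ : Ω → Matrix (Fin m) (Fin m) ℝ)
    (hU : ProbabilityTheory.HasLaw (fun ω => (U₁ ω, U₂ ω)) (BimatrixBeta.bgbI m a b c) P) :
    ProbabilityTheory.HasLaw (fun ω => ((U₁ ω)⁻¹, (U₂ ω)⁻¹))
      (((BimatrixBeta.symmVolume m).prod (BimatrixBeta.symmVolume m)).withDensity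
        fun V => ENNReal.ofReal (BimatrixBeta.bgbIInvDensity m a b c V)) P := by
  -- Since `(m - 1) / 2 ≥ 0` for `m ≥ 1`, the three lower bounds add up to `a + b + c > (m - 1) /
  -- 2`; for `m = 0` this could fail.
  have h1 : (1 : ℝ) ≤ m := by exact_mod_cast hm
  have hinv : Measurable fun U : Matrix (Fin m) (Fin m) ℝ × Matrix (Fin m) (Fin m) ℝ =>
      (U.1⁻¹, U.2⁻¹) :=
    (BimatrixBeta.measurable_matrix_inv.comp measurable_fst).prodMk
      (BimatrixBeta.measurable_matrix_inv.comp measurable_snd)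
  have hlaw : ProbabilityTheory.HasLaw (fun U => (U.1⁻¹, U.2⁻¹)) _
      (BimatrixBeta.bgbI m a b c) :=
    ⟨hinv.aemeasurable, BimatrixBeta.map_inv_bgbI ha hb hc (by linarith)⟩
  exact hlaw.comp hU
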